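/- Let $\lambda>0$ and let $c:\mathbb R\to(0,\infty)$ be measurable with $\int_0^x \frac{dw}{c(w)}$ finite for every $x\in\mathbb R$; put $y(x)=\int_0^x\frac{dw}{c(w)}$. Let $X=(X(s))_{0\le s\le T}$ be a real-valued symmetric telegraph process with space-varying velocity $c$ and rate $\lambda$, started at the origin: almost surely $$X(s)=\int_0^s \varepsilon\,(-1)^{N(r)}\,c(X(r))\,dr,\qquad 0\le s\le T,$$ where $N(r)$ is the number of changes of direction up to time $r$, the waiting times between changes of direction are i.i.d. exponential with rate $\lambda$, and the initial direction $\varepsilon$ is independent of them with $P(\varepsilon=1)=P(\varepsilon=-1)=\tfrac12$. (Thus the particle is assumed not to reach $\pm\infty$ before time $T$; this is no restriction if $y(\pm\infty)=\pm\infty$.) Let $0<t\le T$. Then the set $\{x:|y(x)|=t\}$ consists of exactly two points $x_-<x_+$, with $y(x_\pm)=\pm t$, and the law of $X(t)$ is $$P\{X(t)\in dx\}=\frac{e^{-\lambda t}}{2}\bigl(\delta_{x_-}(dx)+\delta_{x_+}(dx)\bigr)+f(x,t)\,dx,$$ $$f(x,t)=\frac{e^{-\lambda t}}{2c(x)}\Bigl[\lambda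 I_0\bigl(\lambda\sqrt{t^2-y(x)^2}\bigr)+\frac{\partial}{\partial t}I_0\bigl(\lambda\sqrt{t^2-y(x)^2}\bigr)\Bigr]\mathbf 1_{\{|y(x)|<t\}},$$ where $I_0(z)=\sum_{k\ge0}\frac{(z/2)^{2k}}{(k!)^2}$ is the modified Bessel function of order zero. Moreover, if $c$ is continuous, then $u(x,t)=c(x)f(x,t)$, the density of the absolutely continuous part with respect to $dx/c(x)$, is at every point with $|y(x)|<t$ a classical solution of $$\frac{\partial^2u}{\partial t^2}+2\lambda\frac{\partial u}{\partial t}=c(x)\frac{\partial}{\partial x}\Bigl[c(x)\frac{\partial u}{\partial x}\Bigr].$$ -/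

import Mathlib

open MeasureTheory ProbabilityTheory Set Filter Topology

noncomputable section

namespace VarTelegraph

/-- The modified Bessel function of the first kind of order zero,
`I₀(z) = ∑ₖ (z/2)^(2k) / (k!)²`. -/
def besselI0 (z : ℝ) : ℝ := ∑' k : ℕ, (z / 2) ^ (2 * k) / ((k.factorial : ℝ) ^ 2)

/-- The signed travel time `∫₀ˣ dw / c(w)` from the origin to `x`. -/
def travelTime (c : ℝ → ℝ) (x : ℝ) : ℝ := ∫ w in (0 : ℝ)..x, (c w)⁻¹

variable {Ω : Type*}

/-- The epoch `τ₀ + ⋯ + τₙ` of the `(n+1)`-st change of direction. -/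
def epoch (τ : ℕ → Ω → ℝ) (n : ℕ) (ω : Ω) : ℝ := ∑ i ∈ Finset.range (n + 1), τ i ω

/-- The number of changes of direction up to time `s`. -/
def switchCount (τ : ℕ → Ω → ℝ) (s : ℝ) (ω : Ω) : ℕ := Set.ncard {n : ℕ | epoch τ n ω ≤ s}

/-- The direction of motion at time `s`, with initial direction `ε`. -/
def direction (τ : ℕ → Ω → ℝ) (ε : Ω → ℝ) (s : ℝ) (ω : Ω) : ℝ :=
  ε ω * (-1) ^ switchCount τ s ω

/-- `X` is, on the time interval `[0, T]`, a symmetric telegraph process started at the origin, with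
space-varying velocity `c` and switching rate `lam`: the waiting times `τ` between changes of
direction are i.i.d. exponential of rate `lam`, the initial direction `ε` is `±1` with probability
`1/2` each and independent of the waiting times, and `X' = ± c(X)` in integrated form. -/
structure IsTelegraphProcess [MeasurableSpace Ω] (P : Measure Ω) (c : ℝ → ℝ) (lam T : ℝ)
    (τ : ℕ → Ω → ℝ) (ε : Ω → ℝ) (X : ℝ → Ω → ℝ) : Prop where
  measurable_wait : ∀ n, Measurable (τ n)
  law_wait : ∀ n, P.map (τ n) = expMeasure lam
  indep_wait : iIndepFun τ P
  measurable_dir : Measurable ε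
  dir_pos : P {ω | ε ω = 1} = 1 / 2
  dir_neg : P {ω | ε ω = -1} = 1 / 2
  indep_dir : IndepFun (fun ω n => τ n ω) ε P
  aemeasurable_pos : ∀ s ∈ Icc 0 T, AEMeasurable (X s) P
  motion : ∀ᵐ ω ∂P,
    IntervalIntegrable (fun r => direction τ ε r ω * c (X r ω)) volume 0 T ∧
    ∀ s ∈ Icc 0 T, X s ω = ∫ r in (0 : ℝ)..s, direction τ ε r ω * c (X r ω)

/-- The density
`1_{|y(x)| < t} (e^{-λt} / (2 c(x))) [λ I₀(λ √(t² - y(x)²)) + ∂ₜ I₀(λ √(t² - y(x)²))]`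
where `y(x) = ∫₀ˣ dw / c(w)`. -/
def acDensity (c : ℝ → ℝ) (lam : ℝ) (x t : ℝ) : ℝ :=
  {x' : ℝ | |travelTime c x'| < t}.indicator
    (fun x' => Real.exp (-lam * t) / (2 * c x') *
      (lam * besselI0 (lam * √(t ^ 2 - |travelTime c x'| ^ 2)) +
        deriv (fun s : ℝ => besselI0 (lam * √(s ^ 2 - |travelTime c x'| ^ 2))) t)) x

/-- `u` is a classical solution at `(x, t)` of
`∂²u/∂t² + 2λ ∂u/∂t = c(x) ∂/∂x (c(x) ∂u/∂x)`; all derivatives involved are required to exist. -/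
def SolvesTelegraphEqAt (c : ℝ → ℝ) (lam : ℝ) (u : ℝ → ℝ → ℝ) (x t : ℝ) : Prop :=
  (∀ᶠ s in 𝓝 t, DifferentiableAt ℝ (fun s' => u x s') s) ∧
  DifferentiableAt ℝ (deriv fun s' => u x s') t ∧
  (∀ᶠ z in 𝓝 x, DifferentiableAt ℝ (fun z' => u z' t) z) ∧
  DifferentiableAt ℝ (fun z => c z * deriv (fun z' => u z' t) z) x ∧
  deriv (deriv fun s' => u x s') t + 2 * lam * deriv (fun s' => u x s') t =
    c x * deriv (fun z => c z * deriv (fun z' => u z' t) z) x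

end VarTelegraph

end

/-! The idea is to straighten the motion with `y = travelTime c`. While the direction is constant,
`y(X)` moves at speed one, so `y(X(t))` is a unit-velocity telegraph path. As `c` is only
measurable, this is not a pointwise chain rule but a change of variables along the monotone,
absolutely continuous leg (`lintegral_comp_primitive`, `travelTime_path`).

For unit velocity, split by the number of switches. No switch gives the atoms at `±t`. After `2k+1`
switches of a path starting forwards, the total forward time `U` is a sum of `k+1` exponential
waits, the position is `2U - t`, and the independent backward waits must make exactly `k` renewals
by time `t - U`. The density is thus a gamma density times a Poisson weight. After `2k+2` switches
the two directions exchange roles, with counts `k` and `k+1`. Averaging over the initial direction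
and summing over `k` gives the series of `I₀` and of its time derivative (`hasSum_countDensity`,
`tsum_lintegral_unitPosition`).

The atoms at `±t` have positive mass, which forces `±t` into the range of `y`; since `y` is a
measurable embedding, the law of `y(X(t))` determines that of `X(t)`. The differential equation
becomes the constant-coefficient one, because `c ∂/∂x = ∂/∂y`. -/

noncomputable section

namespace VarTelegraph

/-! ### Bessel series: derivative and recurrence -/

/-- The entire function `∑ₖ vᵏ / (k! (k + j)!)`; it equals `v^(-j/2) I_j(2 √v)` for `v > 0`. -/
def besselSeries (j : ℕ) (v : ℝ) : ℝ :=
  ∑' k : ℕ, v ^ k / ((k.factorial : ℝ) * ((k + j).factorial : ℝ))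

lemma norm_besselSeries_term_le (j k : ℕ) (v : ℝ) :
    ‖v ^ k / ((k.factorial : ℝ) * ((k + j).factorial : ℝ))‖ ≤ |v| ^ k / (k.factorial : ℝ) := by
  have h1 : (1 : ℝ) ≤ ((k + j).factorial : ℝ) := by exact_mod_cast Nat.one_le_iff_ne_zero.2 (Nat.factorial_ne_zero _)
  have h2 : (0 : ℝ) < (k.factorial : ℝ) := by exact_mod_cast Nat.factorial_pos k
  rw [norm_div, norm_pow, Real.norm_eq_abs, Real.norm_of_nonneg (by positivity)]
  gcongr
  nlinarith

lemma summable_besselSeries (j : ℕ) (v : ℝ) :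
    Summable fun k : ℕ => v ^ k / ((k.factorial : ℝ) * ((k + j).factorial : ℝ)) :=
  Summable.of_norm_bounded (Real.summable_pow_div_factorial |v|)
    fun k => norm_besselSeries_term_le j k v

/-- Differentiating termwise lowers `k` by one, turning `k! (k + j)!` into `k! (k + 1 + j)!`.
Domination is uniform on a ball of radius `|v| + 1`. -/
lemma hasDerivAt_besselSeries (j : ℕ) (v : ℝ) :
    HasDerivAt (besselSeries j) (besselSeries (j + 1) v) v := by
  set g' : ℕ → ℝ → ℝ := fun k w =>
    (k : ℝ) * w ^ (k - 1) / ((k.factorial : ℝ) * ((k + j).factorial : ℝ)) with hg'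
  have hterm : ∀ k w, g' (k + 1) w
      = w ^ k / ((k.factorial : ℝ) * ((k + (j + 1)).factorial : ℝ)) := by
    intro k w
    have h2 : (k.factorial : ℝ) ≠ 0 := by exact_mod_cast Nat.factorial_ne_zero k
    have h3 : ((k + (j + 1)).factorial : ℝ) ≠ 0 := by exact_mod_cast Nat.factorial_ne_zero _
    have h4 : (k : ℝ) + 1 ≠ 0 := by positivity
    simp only [hg', Nat.factorial_succ k, Nat.add_sub_cancel,
      show k + 1 + j = k + (j + 1) by ring]
    push_cast
    field_simp
  have hzero : ∀ w, g' 0 w = 0 := fun w => by simp [hg']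
  have hbound : Summable fun k : ℕ =>
      if k = 0 then (0 : ℝ) else (|v| + 1) ^ (k - 1) / ((k - 1).factorial : ℝ) := by
    rw [← summable_nat_add_iff 1]
    simpa using Real.summable_pow_div_factorial (|v| + 1)
  have hmain : HasDerivAt (besselSeries j) (∑' k, g' k v) v := by
    refine hasDerivAt_tsum_of_isPreconnected (t := Metric.ball 0 (|v| + 1)) (y₀ := 0) hbound
      Metric.isOpen_ball (convex_ball _ _).isPreconnected ?_ ?_ ?_ (summable_besselSeries j 0) ?_
    · intro k w _
      simpa [hg'] using (hasDerivAt_pow k w).div_const _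
    · intro k w hw
      rcases k with _ | k
      · simp [hzero]
      · rw [hterm]
        refine (norm_besselSeries_term_le (j + 1) k w).trans ?_
        have : |w| ≤ |v| + 1 := by simpa using (mem_ball_zero_iff.1 hw).le
        simp only [Nat.add_eq_zero_iff, one_ne_zero, and_false, if_false, Nat.add_sub_cancel]
        gcongr
    · simp; positivity
    · simp
  convert hmain using 1
  have hs : Summable fun k => g' k v := by
    rw [← summable_nat_add_iff 1]
    simpa only [hterm] using summable_besselSeries (j + 1) v
  rw [hs.tsum_eq_zero_add, hzero, zero_add]
  simp only [hterm]
  rfl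

/-- Comparing coefficients of `v ^ (k + 1)`, it is `(j + 1) + (k + 1) = k + j + 2` over `(k + 1)! (k
+ j + 2)!`. This is the only property of Bessel functions behind the differential equation. -/
lemma besselSeries_recurrence (j : ℕ) (v : ℝ) :
    besselSeries j v = (j + 1) * besselSeries (j + 1) v + v * besselSeries (j + 2) v := by
  have hs1 := (summable_besselSeries (j + 1) v).mul_left ((j : ℝ) + 1)
  have hs2 := (summable_besselSeries (j + 2) v).mul_left v
  unfold besselSeries
  rw [← tsum_mul_left, ← tsum_mul_left, (summable_besselSeries j v).tsum_eq_zero_add,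
    hs1.tsum_eq_zero_add, add_assoc, ← ((summable_nat_add_iff 1).2 hs1).tsum_add hs2]
  congr 1
  · have h3 : (j.factorial : ℝ) ≠ 0 := by exact_mod_cast Nat.factorial_ne_zero j
    have h4 : (j : ℝ) + 1 ≠ 0 := by positivity
    simp only [Nat.factorial_zero, Nat.zero_add, Nat.factorial_succ j]
    push_cast
    field_simp
  · refine tsum_congr fun k => ?_
    have h2 : (k.factorial : ℝ) ≠ 0 := by exact_mod_cast Nat.factorial_ne_zero k
    have h3 : ((k + j + 1).factorial : ℝ) ≠ 0 := by exact_mod_cast Nat.factorial_ne_zero _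
    have h4 : (k : ℝ) + 1 ≠ 0 := by positivity
    have h5 : (k : ℝ) + j + 2 ≠ 0 := by positivity
    rw [show k + 1 + (j + 1) = (k + j + 1) + 1 by ring, show k + (j + 2) = (k + j + 1) + 1 by ring,
      show k + 1 + j = k + j + 1 by ring, Nat.factorial_succ k, Nat.factorial_succ (k + j + 1)]
    push_cast
    have h6 : (k : ℝ) + j + 1 + 1 ≠ 0 := by positivity
    field_simp
    ring

lemma besselI0_mul_sqrt (lam v : ℝ) (hv : 0 ≤ v) :
    besselI0 (lam * √v) = besselSeries 0 (lam ^ 2 * v / 4) := by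
  unfold besselI0 besselSeries
  refine tsum_congr fun k => ?_
  rw [pow_mul, div_pow, mul_pow, Real.sq_sqrt hv, Nat.add_zero, sq (k.factorial : ℝ)]
  norm_num

/-! ### The density for unit velocity and the telegraph equation -/

/-- The density at `y` of the absolutely continuous part of the law at time `t` of the symmetric
telegraph process with unit velocity and rate `lam`, for `|y| < t`. -/
def unitDensity (lam y t : ℝ) : ℝ :=
  Real.exp (-lam * t) / 2 * (lam * besselSeries 0 (lam ^ 2 * (t ^ 2 - y ^ 2) / 4) +
    lam ^ 2 / 2 * t * besselSeries 1 (lam ^ 2 * (t ^ 2 - y ^ 2) / 4))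

lemma hasDerivAt_besselSeries_comp_time (j : ℕ) (lam y t : ℝ) :
    HasDerivAt (fun s => besselSeries j (lam ^ 2 * (s ^ 2 - y ^ 2) / 4))
      (lam ^ 2 / 2 * t * besselSeries (j + 1) (lam ^ 2 * (t ^ 2 - y ^ 2) / 4)) t := by
  have h : HasDerivAt (fun s : ℝ => lam ^ 2 * (s ^ 2 - y ^ 2) / 4) (lam ^ 2 / 2 * t) t := by
    convert! ((((hasDerivAt_id t).pow 2).sub_const (y ^ 2)).const_mul (lam ^ 2)).div_const 4 using 1
    simp; ring
  simpa [mul_comm, Function.comp_def] using (hasDerivAt_besselSeries j _).comp t h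

lemma hasDerivAt_besselSeries_comp_space (j : ℕ) (lam y t : ℝ) :
    HasDerivAt (fun z => besselSeries j (lam ^ 2 * (t ^ 2 - z ^ 2) / 4))
      (-(lam ^ 2 / 2 * y * besselSeries (j + 1) (lam ^ 2 * (t ^ 2 - y ^ 2) / 4))) y := by
  have h : HasDerivAt (fun z : ℝ => lam ^ 2 * (t ^ 2 - z ^ 2) / 4) (-(lam ^ 2 / 2 * y)) y := by
    convert! ((((hasDerivAt_id y).pow 2).const_sub (t ^ 2)).const_mul (lam ^ 2)).div_const 4 using 1
    simp; ring
  simpa [mul_comm, Function.comp_def] using (hasDerivAt_besselSeries j _).comp y h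

/-- The time derivative of `unitDensity`. -/
def unitDensityTime (lam y t : ℝ) : ℝ :=
  Real.exp (-lam * t) / 2 *
    (lam * (lam ^ 2 / 2) * t * besselSeries 1 (lam ^ 2 * (t ^ 2 - y ^ 2) / 4)
      + lam ^ 2 / 2 * besselSeries 1 (lam ^ 2 * (t ^ 2 - y ^ 2) / 4)
      + (lam ^ 2 / 2) ^ 2 * t ^ 2 * besselSeries 2 (lam ^ 2 * (t ^ 2 - y ^ 2) / 4))
    - lam * unitDensity lam y t

/-- The space derivative of `unitDensity`. -/
def unitDensitySpace (lam y t : ℝ) : ℝ :=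
  -(Real.exp (-lam * t) / 2) *
    (lam * (lam ^ 2 / 2) * y * besselSeries 1 (lam ^ 2 * (t ^ 2 - y ^ 2) / 4)
      + (lam ^ 2 / 2) ^ 2 * t * y * besselSeries 2 (lam ^ 2 * (t ^ 2 - y ^ 2) / 4))

lemma hasDerivAt_exp_half (lam t : ℝ) :
    HasDerivAt (fun s => Real.exp (-lam * s) / 2) (-lam * (Real.exp (-lam * t) / 2)) t := by
  convert! (((hasDerivAt_id t).const_mul (-lam)).exp).div_const 2 using 1
  simp; ring

lemma hasDerivAt_unitDensity_time (lam y t : ℝ) :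
    HasDerivAt (fun s => unitDensity lam y s) (unitDensityTime lam y t) t := by
  have h0 := hasDerivAt_besselSeries_comp_time 0 lam y t
  have h1 := hasDerivAt_besselSeries_comp_time 1 lam y t
  convert! (hasDerivAt_exp_half lam t).mul ((h0.const_mul lam).add
    (((hasDerivAt_id t).const_mul (lam ^ 2 / 2)).mul h1)) using 1
  simp only [unitDensityTime, unitDensity, id, Pi.add_apply, Pi.mul_apply]
  ring

lemma hasDerivAt_unitDensity_space (lam y t : ℝ) :
    HasDerivAt (fun z => unitDensity lam z t) (unitDensitySpace lam y t) y := by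
  have h0 := hasDerivAt_besselSeries_comp_space 0 lam y t
  have h1 := hasDerivAt_besselSeries_comp_space 1 lam y t
  convert! ((h0.const_mul lam).add (h1.const_mul (lam ^ 2 / 2 * t))).const_mul
    (Real.exp (-lam * t) / 2) using 1
  simp only [unitDensitySpace]
  ring

lemma exists_hasDerivAt_unitDensity_second (lam y t : ℝ) :
    ∃ utt uyy : ℝ, HasDerivAt (fun s => unitDensityTime lam y s) utt t ∧
      HasDerivAt (fun z => unitDensitySpace lam z t) uyy y ∧
      utt + 2 * lam * unitDensityTime lam y t = uyy := by
  have ht1 := hasDerivAt_besselSeries_comp_time 1 lam y t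
  have ht2 := hasDerivAt_besselSeries_comp_time 2 lam y t
  have hy1 := hasDerivAt_besselSeries_comp_space 1 lam y t
  have hy2 := hasDerivAt_besselSeries_comp_space 2 lam y t
  refine ⟨_, _, ((hasDerivAt_exp_half lam t).mul
    (((((hasDerivAt_id t).const_mul (lam * (lam ^ 2 / 2))).mul ht1).add
      (ht1.const_mul (lam ^ 2 / 2))).add
      ((((hasDerivAt_id t).pow 2).const_mul ((lam ^ 2 / 2) ^ 2)).mul ht2))).sub
      ((hasDerivAt_unitDensity_time lam y t).const_mul lam),
    ((((hasDerivAt_id y).const_mul (lam * (lam ^ 2 / 2))).mul hy1).add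
      (((hasDerivAt_id y).const_mul ((lam ^ 2 / 2) ^ 2 * t)).mul hy2)).const_mul
      (-(Real.exp (-lam * t) / 2)), ?_⟩
  have r0 := besselSeries_recurrence 0 (lam ^ 2 * (t ^ 2 - y ^ 2) / 4)
  have r1 := besselSeries_recurrence 1 (lam ^ 2 * (t ^ 2 - y ^ 2) / 4)
  simp only [unitDensityTime, unitDensity, id, Pi.add_apply, Pi.mul_apply, Pi.pow_apply]
  norm_num at r0 r1 ⊢
  rw [r0]
  generalize besselSeries 3 (lam ^ 2 * (t ^ 2 - y ^ 2) / 4) = b3 at *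
  generalize besselSeries 2 (lam ^ 2 * (t ^ 2 - y ^ 2) / 4) = b2 at *
  generalize besselSeries 1 (lam ^ 2 * (t ^ 2 - y ^ 2) / 4) = b1 at *
  generalize Real.exp (-(lam * t)) = e at *
  -- Without the factor `exp (-lam * t)` the equation reads `W_tt - W_yy = lam ^ 2 * W`. Its part in
  -- `besselSeries 0` is settled by `r0`, its part in `t * besselSeries 1` by `r1`, with weight `e /
  -- 2 * (lam ^ 2 / 2) * lam ^ 2 * t`.
  linear_combination (-e / 4 * lam ^ 4 * t) * r1

/-- For all times near `t` the radicand is nonnegative, so `I₀` of the square root agrees there with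
an entire series in the radicand itself, and so do the time derivatives. -/
lemma mul_acDensity_eq_unitDensity {c : ℝ → ℝ} (hc_pos : ∀ x, 0 < c x) (lam x t : ℝ)
    (h : |travelTime c x| < t) :
    c x * acDensity c lam x t = unitDensity lam (travelTime c x) t := by
  have hev : (fun s : ℝ => besselI0 (lam * √(s ^ 2 - |travelTime c x| ^ 2))) =ᶠ[𝓝 t]
      fun s => besselSeries 0 (lam ^ 2 * (s ^ 2 - travelTime c x ^ 2) / 4) := by
    filter_upwards [lt_mem_nhds h] with s hs
    rw [sq_abs, besselI0_mul_sqrt]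
    have := sq_le_sq' (by linarith [abs_nonneg (travelTime c x)]) hs.le
    rw [sq_abs] at this
    linarith
  have hcx := (hc_pos x).ne'
  rw [acDensity, indicator_of_mem (by exact h), hev.deriv_eq, show besselI0 _ = besselSeries 0 _ from hev.self_of_nhds,
    (hasDerivAt_besselSeries_comp_time 0 lam (travelTime c x) t).deriv, unitDensity]
  field_simp

lemma continuous_travelTime {c : ℝ → ℝ}
    (hc_int : ∀ x, IntervalIntegrable (fun w => (c w)⁻¹) volume 0 x) :
    Continuous (travelTime c) :=
  intervalIntegral.continuous_primitive (fun a b => (hc_int a).symm.trans (hc_int b)) 0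

/-- Continuity of `c` makes `travelTime c` differentiable with derivative `1 / c`, so multiplying by
`c` after each space derivative leaves the derivative in `y`. -/
lemma solvesTelegraphEqAt_acDensity {c : ℝ → ℝ} (hc : Continuous c) (hc_pos : ∀ x, 0 < c x)
    (lam x t : ℝ) (h : |travelTime c x| < t) :
    SolvesTelegraphEqAt c lam (fun x' s => c x' * acDensity c lam x' s) x t := by
  have hcont : Continuous fun w => (c w)⁻¹ := hc.inv₀ fun w => (hc_pos w).ne'
  have hyd : ∀ z, HasDerivAt (travelTime c) (c z)⁻¹ z := fun z => hcont.integral_hasStrictDerivAt 0 z |>.hasDerivAt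
  have hyc : Continuous (travelTime c) :=
    continuous_travelTime fun z => hcont.intervalIntegrable 0 z
  obtain ⟨utt, uyy, htt, hyy, heq⟩ := exists_hasDerivAt_unitDensity_second lam (travelTime c x) t
  have htime : ∀ᶠ s in 𝓝 t, HasDerivAt (fun s' => c x * acDensity c lam x s')
      (unitDensityTime lam (travelTime c x) s) s := by
    filter_upwards [lt_mem_nhds h] with s hs
    refine (hasDerivAt_unitDensity_time lam (travelTime c x) s).congr_of_eventuallyEq ?_
    filter_upwards [lt_mem_nhds hs] with s' hs'
    exact mul_acDensity_eq_unitDensity hc_pos lam x s' hs'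
  have htt' : HasDerivAt (deriv fun s' => c x * acDensity c lam x s') utt t :=
    htt.congr_of_eventuallyEq (htime.mono fun s hs => hs.deriv)
  have hopen : ∀ z, |travelTime c z| < t → ∀ᶠ z' in 𝓝 z, |travelTime c z'| < t := fun z hz =>
    hyc.abs.continuousAt.eventually_lt continuousAt_const hz
  have hspace : ∀ᶠ z in 𝓝 x, HasDerivAt (fun z' => c z' * acDensity c lam z' t)
      (unitDensitySpace lam (travelTime c z) t * (c z)⁻¹) z := by
    filter_upwards [hopen x h] with z hz
    refine ((hasDerivAt_unitDensity_space lam (travelTime c z) t).comp z (hyd z)).congr_of_eventuallyEq ?_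
    filter_upwards [hopen z hz] with z' hz'
    exact mul_acDensity_eq_unitDensity hc_pos lam z' t hz'
  have hyy' : HasDerivAt (fun z => c z * deriv (fun z' => c z' * acDensity c lam z' t) z)
      (uyy * (c x)⁻¹) x := by
    refine (hyy.comp x (hyd x)).congr_of_eventuallyEq ?_
    filter_upwards [hspace] with z hz
    have := (hc_pos z).ne'
    rw [hz.deriv, Function.comp_apply]
    field_simp
  refine ⟨htime.mono fun s hs => hs.differentiableAt, htt'.differentiableAt,
    hspace.mono fun z hz => hz.differentiableAt, hyy'.differentiableAt, ?_⟩
  rw [htt'.deriv, hyy'.deriv, htime.self_of_nhds.deriv, heq]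
  have := (hc_pos x).ne'
  field_simp

/-! ### Change of variables along a primitive -/

section ChangeOfVariables

variable {a b : ℝ} {h F : ℝ → ℝ}

lemma strictMonoOn_of_primitive (hh : IntervalIntegrable h volume a b) (hpos : ∀ r, 0 < h r)
    (hF : ∀ s ∈ Icc a b, F s = F a + ∫ r in a..s, h r) : StrictMonoOn F (Icc a b) := by
  intro s hs s' hs' hlt
  have hi : ∀ {u}, u ∈ Icc a b → IntervalIntegrable h volume a u := fun {u} hu =>
    hh.mono_set (by rw [uIcc_of_le hu.1, uIcc_of_le (hu.1.trans hu.2)]; exact Icc_subset_Icc_right hu.2)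
  have hss : IntervalIntegrable h volume s s' := (hi hs).symm.trans (hi hs')
  have := intervalIntegral.intervalIntegral_pos_of_pos hss hpos hlt
  have h2 := intervalIntegral.integral_add_adjacent_intervals (hi hs) hss
  rw [hF s hs, hF s' hs']
  linarith

lemma continuousOn_of_primitive (hab : a ≤ b) (hh : IntervalIntegrable h volume a b)
    (hF : ∀ s ∈ Icc a b, F s = F a + ∫ r in a..s, h r) : ContinuousOn F (Icc a b) := by
  have := intervalIntegral.continuousOn_primitive_interval' hh left_mem_uIcc
  rw [uIcc_of_le hab] at this
  exact (continuousOn_const.add this).congr hF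

/-- Both measures are compared on half-lines. As `F` is increasing and continuous, the preimage of a
half-line is some `Ioc a s`, whose mass `∫ h = F s - F a` is a Lebesgue length. No derivative of `F`
is needed. -/
lemma map_withDensity_of_primitive (hab : a ≤ b) (hh : IntervalIntegrable h volume a b)
    (hpos : ∀ r, 0 < h r) (hF : ∀ s ∈ Icc a b, F s = F a + ∫ r in a..s, h r) :
    ((volume.restrict (Ioc a b)).withDensity fun r => ENNReal.ofReal (h r)).map F =
      volume.restrict (Ioc (F a) (F b)) := by
  have hmono := strictMonoOn_of_primitive hh hpos hF
  have hcont := continuousOn_of_primitive hab hh hF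
  have hFm : AEMeasurable F ((volume.restrict (Ioc a b)).withDensity
      fun r => ENNReal.ofReal (h r)) :=
    ((hcont.mono Ioc_subset_Icc_self).aemeasurable measurableSet_Ioc).mono_ac
      (withDensity_absolutelyContinuous _ _)
  symm
  refine Measure.ext_of_Iic _ _ fun z => ?_
  obtain ⟨s, hs, hpre, himg⟩ : ∃ s ∈ Icc a b, F ⁻¹' Iic z ∩ Ioc a b = Ioc a s ∧
      Iic z ∩ Ioc (F a) (F b) = Ioc (F a) (F s) := by
    have ha : a ∈ Icc a b := left_mem_Icc.2 hab
    have hb : b ∈ Icc a b := right_mem_Icc.2 hab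
    rcases lt_or_ge z (F a) with hz | hz
    · refine ⟨a, ha, ?_, ?_⟩
      · rw [Ioc_self, eq_empty_iff_forall_notMem]
        rintro r ⟨h1, h2⟩
        have := hmono ha (Ioc_subset_Icc_self h2) h2.1
        exact absurd (h1 : F r ≤ z) (not_le.2 (hz.trans this))
      · rw [Ioc_self, eq_empty_iff_forall_notMem]
        rintro r ⟨h1, h2⟩
        exact absurd (h1 : r ≤ z) (not_le.2 (hz.trans h2.1))
    rcases lt_or_ge z (F b) with hz' | hz'
    · obtain ⟨s, hs, rfl⟩ := intermediate_value_Icc hab hcont ⟨hz, hz'.le⟩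
      refine ⟨s, hs, ?_, ?_⟩
      · ext r
        constructor
        · rintro ⟨h1, h2⟩
          exact ⟨h2.1, (hmono.le_iff_le (Ioc_subset_Icc_self h2) hs).1 h1⟩
        · rintro ⟨h1, h2⟩
          exact ⟨(hmono.le_iff_le ⟨h1.le, h2.trans hs.2⟩ hs).2 h2, h1, h2.trans hs.2⟩
      · ext r
        constructor
        · rintro ⟨h1, h2⟩
          exact ⟨h2.1, h1⟩
        · rintro ⟨h1, h2⟩
          exact ⟨h2, h1, h2.trans hz'.le⟩
    · refine ⟨b, hb, inter_eq_right.2 fun r hr => ?_, inter_eq_right.2 fun r hr => hr.2.trans hz'⟩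
      exact ((hmono.le_iff_le (Ioc_subset_Icc_self hr) hb).2 hr.2).trans hz'
  have hi : IntegrableOn h (Ioc a s) volume :=
    ((intervalIntegrable_iff_integrableOn_Ioc_of_le hab).1 hh).mono_set (Ioc_subset_Ioc_right hs.2)
  rw [Measure.map_apply_of_aemeasurable hFm measurableSet_Iic, withDensity_apply',
    Measure.restrict_restrict' measurableSet_Ioc, hpre, Measure.restrict_apply measurableSet_Iic,
    himg, Real.volume_Ioc, ← ofReal_integral_eq_lintegral_ofReal hi
      (Eventually.of_forall fun r => (hpos r).le), ← intervalIntegral.integral_of_le hs.1,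
    hF s hs, add_sub_cancel_left]

/-- Change of variables along a primitive `F` of a positive integrable function `h`. -/
lemma lintegral_comp_primitive (hab : a ≤ b) (hh : IntervalIntegrable h volume a b)
    (hpos : ∀ r, 0 < h r) (hF : ∀ s ∈ Icc a b, F s = F a + ∫ r in a..s, h r)
    {g : ℝ → ENNReal} (hg : Measurable g) :
    ∫⁻ r in Ioc a b, ENNReal.ofReal (h r) * g (F r) = ∫⁻ w in Ioc (F a) (F b), g w := by
  have hFm : AEMeasurable F (volume.restrict (Ioc a b)) :=
    ((continuousOn_of_primitive hab hh hF).mono Ioc_subset_Icc_self).aemeasurable measurableSet_Ioc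
  have hhm : AEMeasurable (fun r => ENNReal.ofReal (h r)) (volume.restrict (Ioc a b)) :=
    ((intervalIntegrable_iff_integrableOn_Ioc_of_le hab).1 hh).aemeasurable.ennreal_ofReal
  rw [← map_withDensity_of_primitive hab hh hpos hF, lintegral_map' hg.aemeasurable
    (hFm.mono_ac (withDensity_absolutelyContinuous _ _)),
    lintegral_withDensity_eq_lintegral_mul₀ (g := fun r => g (F r)) hhm (hg.comp_aemeasurable hFm)]
  rfl

end ChangeOfVariables

/-! ### Travel time along a path -/

section Path

variable {c : ℝ → ℝ}

lemma travelTime_sub (hc_int : ∀ x, IntervalIntegrable (fun w => (c w)⁻¹) volume 0 x) (x x' : ℝ) :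
    travelTime c x' - travelTime c x = ∫ w in x..x', (c w)⁻¹ :=
  intervalIntegral.integral_interval_sub_left (hc_int x') (hc_int x)

lemma strictMono_travelTime (hc_pos : ∀ x, 0 < c x)
    (hc_int : ∀ x, IntervalIntegrable (fun w => (c w)⁻¹) volume 0 x) :
    StrictMono (travelTime c) := by
  intro x x' hlt
  have := intervalIntegral.intervalIntegral_pos_of_pos ((hc_int x).symm.trans (hc_int x'))
    (fun w => inv_pos.2 (hc_pos w)) hlt
  rw [← travelTime_sub hc_int] at this
  linarith

/-- While the direction of motion is constant, the travel time changes at unit speed. -/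
lemma travelTime_of_constant_direction (hc_meas : Measurable c) (hc_pos : ∀ x, 0 < c x)
    (hc_int : ∀ x, IntervalIntegrable (fun w => (c w)⁻¹) volume 0 x)
    {a b d : ℝ} (hab : a ≤ b) (hd : d = 1 ∨ d = -1) {dir x : ℝ → ℝ}
    (hdir : ∀ r ∈ Ico a b, dir r = d)
    (hint : IntervalIntegrable (fun r => dir r * c (x r)) volume a b)
    (hx : ∀ s ∈ Icc a b, x s = x a + ∫ r in a..s, dir r * c (x r)) :
    travelTime c (x b) = travelTime c (x a) + d * (b - a) := by
  have hdd : d * d = 1 := by rcases hd with rfl | rfl <;> norm_num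
  have hae : ∀ᵐ r ∂(volume : Measure ℝ), r ≠ b := compl_mem_ae_iff.2 (measure_singleton b)
  have hcongr : ∀ᵐ r, r ∈ Ioc a b → dir r * c (x r) = d * c (x r) := by
    filter_upwards [hae] with r hr hr'
    rw [hdir r ⟨hr'.1.le, lt_of_le_of_ne hr'.2 hr⟩]
  have hint' : IntervalIntegrable (fun r => c (x r)) volume a b := by
    have : IntervalIntegrable (fun r => d * c (x r)) volume a b :=
      hint.congr_ae (by
        rw [uIoc_of_le hab]
        exact (ae_restrict_iff' measurableSet_Ioc).2 hcongr)
    refine (this.const_mul d).congr fun r _ => ?_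
    rw [← mul_assoc, hdd, one_mul]
  -- Multiplication by `d` makes the leg increasing, whichever its direction.
  have hF : ∀ s ∈ Icc a b, d * x s = d * x a + ∫ r in a..s, c (x r) := by
    intro s hs
    have : ∫ r in a..s, dir r * c (x r) = ∫ r in a..s, d * c (x r) := by
      refine intervalIntegral.integral_congr_ae ?_
      filter_upwards [hcongr] with r hr hr'
      rw [uIoc_of_le hs.1] at hr'
      exact hr ⟨hr'.1, hr'.2.trans hs.2⟩
    rw [hx s hs, this, intervalIntegral.integral_const_mul, mul_add, ← mul_assoc, hdd, one_mul]
  have hle : d * x a ≤ d * x b :=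
    (strictMonoOn_of_primitive (F := fun s => d * x s) hint' (fun r => hc_pos _) hF).monotoneOn
      (left_mem_Icc.2 hab) (right_mem_Icc.2 hab) hab
  -- Tested against this function, the speed `c (x r)` cancels: one side of the change of variables
  -- becomes the elapsed time `b - a`, the other the travel time between the endpoints.
  have hgm : Measurable fun w => (c (d * w))⁻¹ := (hc_meas.comp (measurable_const_mul d)).inv
  have key := lintegral_comp_primitive (F := fun s => d * x s) hab hint' (fun r => hc_pos _) hF
    hgm.ennreal_ofReal
  have hone : ∀ r, ENNReal.ofReal (c (x r)) * ENNReal.ofReal (c (d * (d * x r)))⁻¹ = 1 := by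
    intro r
    rw [← ENNReal.ofReal_mul (hc_pos _).le, ← mul_assoc, hdd, one_mul,
      mul_inv_cancel₀ (hc_pos _).ne', ENNReal.ofReal_one]
  simp only [hone, lintegral_const, one_mul, Measure.restrict_apply MeasurableSet.univ,
    univ_inter, Real.volume_Ioc] at key
  have hreal : ∫ w in (d * x a)..(d * x b), (c (d * w))⁻¹ = b - a := by
    rw [intervalIntegral.integral_of_le hle, integral_eq_lintegral_of_nonneg_ae
      (Eventually.of_forall fun w => (inv_pos.2 (hc_pos _)).le) hgm.aestronglyMeasurable, ← key,
      ENNReal.toReal_ofReal (sub_nonneg.2 hab)]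
  have := intervalIntegral.mul_integral_comp_mul_left (f := fun w => (c w)⁻¹) (a := d * x a)
    (b := d * x b) (c := d)
  rw [hreal, ← mul_assoc, ← mul_assoc, hdd, one_mul, one_mul, ← travelTime_sub hc_int] at this
  linarith

variable {Ω : Type*}

lemma switchCount_eq {τ : ℕ → Ω → ℝ} {ω : Ω} (hτ : ∀ i, 0 ≤ τ i ω) {n : ℕ} {s : ℝ}
    (h1 : ∑ i ∈ Finset.range n, τ i ω ≤ s) (h2 : s < ∑ i ∈ Finset.range (n + 1), τ i ω) :
    switchCount τ s ω = n := by
  have hmono : Monotone fun m => ∑ i ∈ Finset.range m, τ i ω :=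
    monotone_nat_of_le_succ fun m => by rw [Finset.sum_range_succ]; linarith [hτ m]
  have : {m : ℕ | epoch τ m ω ≤ s} = (Finset.range n : Set ℕ) := by
    ext m
    simp only [mem_ofPred_eq, epoch, Finset.coe_range, mem_Iio]
    constructor
    · intro h
      by_contra hm
      exact absurd (hmono (show n + 1 ≤ m + 1 by omega)) (by simp only; linarith)
    · intro h
      exact (hmono (show m + 1 ≤ n by omega)).trans h1
  rw [switchCount, this, ncard_coe_finset, Finset.card_range]

/-- Between the `n`-th and the `(n+1)`-st change of direction, the travel time is that of the
telegraph path with unit velocity. -/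
lemma travelTime_path (hc_meas : Measurable c) (hc_pos : ∀ x, 0 < c x)
    (hc_int : ∀ x, IntervalIntegrable (fun w => (c w)⁻¹) volume 0 x) {T : ℝ}
    {τ : ℕ → Ω → ℝ} {ε : Ω → ℝ} {X : ℝ → Ω → ℝ} {ω : Ω} (hτ : ∀ i, 0 ≤ τ i ω)
    (hε : ε ω = 1 ∨ ε ω = -1)
    (hint : IntervalIntegrable (fun r => direction τ ε r ω * c (X r ω)) volume 0 T)
    (hX : ∀ s ∈ Icc 0 T, X s ω = ∫ r in (0 : ℝ)..s, direction τ ε r ω * c (X r ω)) (n : ℕ) :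
    ∀ s ≤ T, ∑ i ∈ Finset.range n, τ i ω ≤ s → s ≤ ∑ i ∈ Finset.range (n + 1), τ i ω →
      travelTime c (X s ω) = ε ω * (∑ i ∈ Finset.range n, (-1) ^ i * τ i ω +
        (-1) ^ n * (s - ∑ i ∈ Finset.range n, τ i ω)) := by
  have hstep : ∀ n : ℕ, ∀ s ≤ T, ∑ i ∈ Finset.range n, τ i ω ≤ s →
      s ≤ ∑ i ∈ Finset.range (n + 1), τ i ω → travelTime c (X s ω) =
        travelTime c (X (∑ i ∈ Finset.range n, τ i ω) ω) +
          ε ω * (-1) ^ n * (s - ∑ i ∈ Finset.range n, τ i ω) := by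
    intro n s hsT h1 h2
    have h0 : 0 ≤ ∑ i ∈ Finset.range n, τ i ω := Finset.sum_nonneg fun i _ => hτ i
    have hi : ∀ u v, 0 ≤ u → u ≤ T → 0 ≤ v → v ≤ T →
        IntervalIntegrable (fun r => direction τ ε r ω * c (X r ω)) volume u v := by
      intro u v hu huT hv hvT
      refine hint.mono_set ?_
      rw [uIcc_of_le (hu.trans huT)]
      exact uIcc_subset_Icc ⟨hu, huT⟩ ⟨hv, hvT⟩
    refine travelTime_of_constant_direction (x := fun r => X r ω)
      (dir := fun r => direction τ ε r ω) hc_meas hc_pos hc_int h1 ?_ ?_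
      (hi _ _ h0 (h1.trans hsT) (h0.trans h1) hsT) ?_
    · rcases hε with h | h <;> rcases neg_one_pow_eq_or ℝ n with h' | h' <;> simp [h, h']
    · intro r hr
      rw [direction, switchCount_eq hτ hr.1 (hr.2.trans_le h2)]
    · intro r hr
      have hr0 := h0.trans hr.1
      have hrT := hr.2.trans hsT
      rw [hX r ⟨hr0, hrT⟩, hX _ ⟨h0, h1.trans hsT⟩, intervalIntegral.integral_add_adjacent_intervals
        (hi _ _ le_rfl (hr0.trans hrT) h0 (h1.trans hsT)) (hi _ _ h0 (h1.trans hsT) hr0 hrT)]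
  -- The bound `s ≤ ∑` is not strict, so that the induction hypothesis can be evaluated at the
  -- switching epoch itself, where the next leg starts.
  induction n with
  | zero =>
    intro s hsT h1 h2
    have h0T : (0 : ℝ) ∈ Icc 0 T := ⟨le_rfl, (by simpa using h1 : (0 : ℝ) ≤ s).trans hsT⟩
    rw [hstep 0 s hsT h1 h2]
    simp [hX 0 h0T, travelTime]
  | succ n ih =>
    intro s hsT h1 h2
    rw [hstep (n + 1) s hsT h1 h2, ih _ (h1.trans hsT)
      (by rw [Finset.sum_range_succ]; linarith [hτ n]) le_rfl, Finset.sum_range_succ,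
      Finset.sum_range_succ _ n]
    ring

end Path

/-! ### Poisson weights and exponential laws -/

/-- The weight at `n` of the Poisson law with mean `lam * b`. -/
def poissonWeight (lam : ℝ) (n : ℕ) (b : ℝ) : ℝ :=
  Real.exp (-(lam * b)) * (lam * b) ^ n / (n.factorial : ℝ)

lemma poissonWeight_nonneg {lam b : ℝ} (hlam : 0 ≤ lam) (hb : 0 ≤ b) (n : ℕ) :
    0 ≤ poissonWeight lam n b := by
  unfold poissonWeight
  positivity

@[fun_prop]
lemma continuous_poissonWeight (lam : ℝ) (n : ℕ) : Continuous (poissonWeight lam n) := by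
  unfold poissonWeight
  fun_prop

lemma hasSum_poissonWeight (lam b : ℝ) : HasSum (fun n => poissonWeight lam n b) 1 := by
  have h := (NormedSpace.expSeries_div_hasSum_exp (lam * b)).mul_left (Real.exp (-(lam * b)))
  rw [← Real.exp_eq_exp_ℝ, ← Real.exp_add, neg_add_cancel, Real.exp_zero] at h
  simpa only [poissonWeight, mul_div_assoc] using h

/-- The exponentials multiply to a constant, leaving the integral of `s ^ n`. It gives both the
gamma density of sums of waits and the Poisson law of the renewal count. -/
lemma lintegral_poissonWeight_convolution {lam v : ℝ} (hlam : 0 < lam) (hv : 0 ≤ v) (n : ℕ) :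
    ∫⁻ s in Ioc 0 v, ENNReal.ofReal (lam * poissonWeight lam n s) *
      ENNReal.ofReal (poissonWeight lam 0 (v - s)) = ENNReal.ofReal (poissonWeight lam (n + 1) v) := by
  have h1 : ∀ s ∈ Ioc 0 v, ENNReal.ofReal (lam * poissonWeight lam n s) *
      ENNReal.ofReal (poissonWeight lam 0 (v - s)) =
      ENNReal.ofReal (lam ^ (n + 1) * Real.exp (-(lam * v)) / n.factorial * s ^ n) := by
    intro s hs
    rw [← ENNReal.ofReal_mul (mul_nonneg hlam.le (poissonWeight_nonneg hlam.le hs.1.le n))]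
    congr 1
    have : Real.exp (-(lam * v)) = Real.exp (-(lam * s)) * Real.exp (-(lam * (v - s))) := by
      rw [← Real.exp_add]; ring_nf
    rw [this, poissonWeight, poissonWeight]
    simp only [pow_zero, Nat.factorial_zero, Nat.cast_one, div_one, mul_one]
    ring
  rw [setLIntegral_congr_fun measurableSet_Ioc h1]
  have hcont : Continuous fun s : ℝ => lam ^ (n + 1) * Real.exp (-(lam * v)) / n.factorial * s ^ n := by
    fun_prop
  rw [← ofReal_integral_eq_lintegral_ofReal (hcont.integrableOn_Ioc)
    ((ae_restrict_iff' measurableSet_Ioc).2 (Eventually.of_forall fun s hs => by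
      have := hs.1.le
      simp only [Pi.zero_apply]; positivity)), ← intervalIntegral.integral_of_le hv,
    intervalIntegral.integral_const_mul, integral_pow]
  congr 1
  have h2 : (n.factorial : ℝ) ≠ 0 := by exact_mod_cast Nat.factorial_ne_zero n
  have h3 : (n : ℝ) + 1 ≠ 0 := by positivity
  rw [poissonWeight, Nat.factorial_succ]
  push_cast
  field_simp
  ring

lemma lintegral_expMeasure (lam : ℝ) {g : ℝ → ENNReal} (hg : Measurable g) :
    ∫⁻ u, g u ∂(expMeasure lam) =
      ∫⁻ u in Ioi 0, ENNReal.ofReal (lam * poissonWeight lam 0 u) * g u := by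
  have hm : Measurable (exponentialPDF lam) := (measurable_exponentialPDFReal lam).ennreal_ofReal
  have h1 : expMeasure lam = volume.withDensity (exponentialPDF lam) := rfl
  rw [h1, lintegral_withDensity_eq_lintegral_mul _ hm hg, ← setLIntegral_congr Ioi_ae_eq_Ici.symm,
    ← lintegral_indicator measurableSet_Ici]
  refine lintegral_congr fun u => ?_
  by_cases hu : 0 ≤ u
  · rw [indicator_of_mem (by exact hu), Pi.mul_apply, exponentialPDF_of_nonneg hu]
    simp [poissonWeight]
  · rw [indicator_of_notMem (by exact hu), Pi.mul_apply, exponentialPDF_of_neg (not_le.1 hu),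
      zero_mul]

lemma expMeasure_Ioi {lam b : ℝ} (hlam : 0 < lam) (hb : 0 ≤ b) :
    expMeasure lam (Ioi b) = ENNReal.ofReal (poissonWeight lam 0 b) := by
  have := isProbabilityMeasure_expMeasure hlam
  rw [← compl_Iic, prob_compl_eq_one_sub measurableSet_Iic, ← ofReal_cdf,
    cdf_expMeasure_eq hlam, if_pos hb, ← ENNReal.ofReal_one,
    ← ENNReal.ofReal_sub]
  · simp [poissonWeight]
  · have : Real.exp (-(lam * b)) ≤ 1 := Real.exp_le_one_iff.2 (by nlinarith)
    linarith

lemma lintegral_indepFun {Ω α β : Type*} [MeasurableSpace Ω] [MeasurableSpace α]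
    [MeasurableSpace β] {P : Measure Ω} [IsProbabilityMeasure P] {U : Ω → α} {V : Ω → β}
    (hU : Measurable U) (hV : Measurable V) (h : IndepFun U V P) {g : α × β → ENNReal}
    (hg : Measurable g) :
    ∫⁻ ω, g (U ω, V ω) ∂P = ∫⁻ u, ∫⁻ ω, g (u, V ω) ∂P ∂(P.map U) := by
  have := Measure.isProbabilityMeasure_map (μ := P) hV.aemeasurable
  rw [← lintegral_map (f := g) hg (hU.prodMk hV),
    (indepFun_iff_map_prod_eq_prod_map_map hU.aemeasurable hV.aemeasurable).1 h,
    lintegral_prod _ hg.aemeasurable]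
  refine lintegral_congr fun u => ?_
  rw [lintegral_map (f := fun v => g (u, v)) (hg.comp measurable_prodMk_left) hV]

/-! ### Partial sums of waiting times -/

section Waiting

variable {Ω : Type*} [MeasurableSpace Ω] {P : Measure Ω} {lam : ℝ}
  {σ : ℕ → Ω → ℝ}

/-- Induction: given the sum `s`, the next wait puts the new sum at `v > s` with exponential density
in `v - s`. After exchanging the integrals, the inner one is the convolution above. -/
lemma lintegral_partialSum_succ [IsProbabilityMeasure P] (hlam : 0 < lam) (hm : ∀ n, Measurable (σ n))
    (hl : ∀ n, P.map (σ n) = expMeasure lam) (hi : iIndepFun σ P) (n : ℕ) :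
    ∀ {g : ℝ → ENNReal}, Measurable g →
    ∫⁻ s, g s ∂(P.map fun ω => ∑ i ∈ Finset.range (n + 1), σ i ω) =
      ∫⁻ s in Ioi 0, ENNReal.ofReal (lam * poissonWeight lam n s) * g s := by
  induction n with
  | zero =>
    intro g hg
    simp only [zero_add, Finset.sum_range_one]
    rw [show (fun ω => σ 0 ω) = σ 0 from rfl, hl, lintegral_expMeasure lam hg]
  | succ n ih =>
    intro g hg
    have hSm : Measurable fun ω => ∑ i ∈ Finset.range (n + 1), σ i ω :=
      Finset.measurable_fun_sum _ fun i _ => hm i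
    have hind : IndepFun (fun ω => ∑ i ∈ Finset.range (n + 1), σ i ω) (σ (n + 1)) P := by
      have := hi.indepFun_sum_range_succ hm (n + 1)
      convert this using 1
      ext ω; simp
    have hk : ∀ k, Measurable fun s => ENNReal.ofReal (lam * poissonWeight lam k s) := fun k =>
      (continuous_const.mul (continuous_poissonWeight lam k)).measurable.ennreal_ofReal
    have hk0 : Measurable fun s => ENNReal.ofReal (poissonWeight lam 0 s) :=
      (continuous_poissonWeight lam 0).measurable.ennreal_ofReal
    have hinner : ∀ s, ∫⁻ ω, g (s + σ (n + 1) ω) ∂P =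
        ∫⁻ v, (Ioi s).indicator (fun v => ENNReal.ofReal (lam * poissonWeight lam 0 (v - s)) * g v) v := by
      intro s
      rw [← lintegral_map (f := fun u => g (s + u)) (hg.comp (measurable_const_add s)) (hm (n + 1)),
        hl, lintegral_expMeasure lam (g := fun u => g (s + u)) (hg.comp (measurable_const_add s)),
        ← lintegral_indicator measurableSet_Ioi, ← lintegral_sub_right_eq_self _ s]
      refine lintegral_congr fun v => ?_
      by_cases hv : s < v
      · rw [indicator_of_mem (show v ∈ Ioi s from hv), indicator_of_mem (mem_Ioi.2 (sub_pos.2 hv)),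
          add_sub_cancel]
      · rw [indicator_of_notMem (show v ∉ Ioi s from hv), indicator_of_notMem (by simpa using hv)]
    simp only [Finset.sum_range_succ _ (n + 1)]
    rw [lintegral_map hg (by fun_prop), lintegral_indepFun hSm (hm (n + 1)) hind
      (g := fun p => g (p.1 + p.2)) (hg.comp (measurable_fst.add measurable_snd))]
    simp only [hinner]
    have hset : MeasurableSet {p : ℝ × ℝ | p.1 < p.2} := measurableSet_lt measurable_fst measurable_snd
    have hjoint : Measurable fun p : ℝ × ℝ => (Ioi p.1).indicator
        (fun v => ENNReal.ofReal (lam * poissonWeight lam 0 (v - p.1)) * g v) p.2 := by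
      have : Measurable fun p : ℝ × ℝ =>
          ENNReal.ofReal (lam * poissonWeight lam 0 (p.2 - p.1)) * g p.2 :=
        ((hk 0).comp (measurable_snd.sub measurable_fst)).mul (hg.comp measurable_snd)
      exact this.indicator hset
    rw [ih hjoint.lintegral_prod_right']
    have hswap : ∀ s, ENNReal.ofReal (lam * poissonWeight lam n s) *
        ∫⁻ v, (Ioi s).indicator
          (fun v => ENNReal.ofReal (lam * poissonWeight lam 0 (v - s)) * g v) v =
        ∫⁻ v, ENNReal.ofReal (lam * poissonWeight lam n s) * (Ioi s).indicator
          (fun v => ENNReal.ofReal (lam * poissonWeight lam 0 (v - s)) * g v) v := fun s =>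
      (lintegral_const_mul _ (hjoint.comp measurable_prodMk_left)).symm
    simp only [hswap]
    rw [lintegral_lintegral_swap
      (((hk n).comp measurable_fst).mul hjoint).aemeasurable,
      ← lintegral_indicator measurableSet_Ioi]
    refine lintegral_congr fun v => ?_
    rcases le_or_gt v 0 with hv | hv
    · rw [indicator_of_notMem (by simpa using hv), ← lintegral_zero (μ := volume.restrict (Ioi (0 : ℝ)))]
      refine setLIntegral_congr_fun measurableSet_Ioi fun s hs => ?_
      rw [indicator_of_notMem (by simpa using hv.trans (le_of_lt hs)), mul_zero]
    · rw [indicator_of_mem (by exact hv)]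
      have h1 : ∀ s ∈ Ioi (0 : ℝ), ENNReal.ofReal (lam * poissonWeight lam n s) * (Ioi s).indicator
          (fun v => ENNReal.ofReal (lam * poissonWeight lam 0 (v - s)) * g v) v =
          (Iio v).indicator (fun s => ENNReal.ofReal lam * g v *
            (ENNReal.ofReal (lam * poissonWeight lam n s) *
              ENNReal.ofReal (poissonWeight lam 0 (v - s)))) s := by
        intro s _
        by_cases hsv : s < v
        · rw [indicator_of_mem (by exact hsv), indicator_of_mem (by exact hsv),
            ENNReal.ofReal_mul (q := poissonWeight lam 0 (v - s)) hlam.le]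
          ring
        · rw [indicator_of_notMem (by exact hsv), indicator_of_notMem (by exact hsv), mul_zero]
      rw [setLIntegral_congr_fun measurableSet_Ioi h1, setLIntegral_indicator measurableSet_Iio,
        Iio_inter_Ioi, setLIntegral_congr Ioo_ae_eq_Ioc, lintegral_const_mul _ (by fun_prop),
        lintegral_poissonWeight_convolution hlam hv.le, ENNReal.ofReal_mul hlam.le]
      ring

lemma ae_nonneg_wait (hm : ∀ n, Measurable (σ n)) (hl : ∀ n, P.map (σ n) = expMeasure lam) :
    ∀ᵐ ω ∂P, ∀ n, 0 ≤ σ n ω := by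
  refine ae_all_iff.2 fun n => ?_
  have : ∀ᵐ u ∂(P.map (σ n)), 0 ≤ u := by
    rw [ae_iff, hl, show {a : ℝ | ¬ 0 ≤ a} = Iio 0 by ext; simp, ← setLIntegral_one,
      ← lintegral_indicator measurableSet_Iio,
      lintegral_expMeasure lam (measurable_const.indicator measurableSet_Iio),
      ← lintegral_zero (μ := volume.restrict (Ioi (0 : ℝ)))]
    refine setLIntegral_congr_fun measurableSet_Ioi fun s hs => ?_
    rw [indicator_of_notMem (by simpa using le_of_lt hs), mul_zero]
  exact ae_of_ae_map (hm n).aemeasurable this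

/-- The number of renewals up to time `b` has a Poisson law. -/
lemma measure_partialSum_le_lt [IsProbabilityMeasure P] (hlam : 0 < lam) (hm : ∀ n, Measurable (σ n))
    (hl : ∀ n, P.map (σ n) = expMeasure lam) (hi : iIndepFun σ P) (n : ℕ) {b : ℝ} (hb : 0 ≤ b) :
    P {ω | ∑ i ∈ Finset.range n, σ i ω ≤ b ∧ b < ∑ i ∈ Finset.range n, σ i ω + σ n ω} =
      ENNReal.ofReal (poissonWeight lam n b) := by
  -- The empty sum has no density and is treated apart.
  rcases n with _ | n
  · simp only [Finset.range_zero, Finset.sum_empty, hb, true_and, zero_add]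
    rw [← expMeasure_Ioi hlam hb, ← hl 0, Measure.map_apply (hm 0) measurableSet_Ioi]
    rfl
  have hSm : Measurable fun ω => ∑ i ∈ Finset.range (n + 1), σ i ω :=
    Finset.measurable_fun_sum _ fun i _ => hm i
  have hind : IndepFun (fun ω => ∑ i ∈ Finset.range (n + 1), σ i ω) (σ (n + 1)) P := by
    have := hi.indepFun_sum_range_succ hm (n + 1)
    convert this using 1
    ext ω; simp
  have hset : MeasurableSet {p : ℝ × ℝ | p.1 ≤ b ∧ b < p.1 + p.2} :=
    (measurableSet_le measurable_fst measurable_const).inter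
      (measurableSet_lt measurable_const (measurable_fst.add measurable_snd))
  have hpre : {ω | ∑ i ∈ Finset.range (n + 1), σ i ω ≤ b ∧
      b < ∑ i ∈ Finset.range (n + 1), σ i ω + σ (n + 1) ω} =
      (fun ω => (∑ i ∈ Finset.range (n + 1), σ i ω, σ (n + 1) ω)) ⁻¹'
        {p : ℝ × ℝ | p.1 ≤ b ∧ b < p.1 + p.2} := rfl
  rw [hpre, ← lintegral_indicator_one ((hSm.prodMk (hm (n + 1))) hset)]
  have := lintegral_indepFun hSm (hm (n + 1)) hind
    (g := {p : ℝ × ℝ | p.1 ≤ b ∧ b < p.1 + p.2}.indicator 1) (measurable_one.indicator hset)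
  refine (lintegral_congr fun ω => rfl).trans (this.trans ?_)
  have hmeas : Measurable fun s => ∫⁻ ω, {p : ℝ × ℝ | p.1 ≤ b ∧ b < p.1 + p.2}.indicator
      (1 : ℝ × ℝ → ENNReal) (s, σ (n + 1) ω) ∂P :=
    ((measurable_one.indicator hset).comp
      (measurable_fst.prodMk ((hm (n + 1)).comp measurable_snd))).lintegral_prod_right'
  rw [lintegral_partialSum_succ hlam hm hl hi n hmeas, ← lintegral_poissonWeight_convolution hlam hb,
    ← Ioi_inter_Iic, inter_comm, ← setLIntegral_indicator measurableSet_Iic]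
  refine setLIntegral_congr_fun measurableSet_Ioi fun s _ => ?_
  by_cases hs : s ≤ b
  · rw [indicator_of_mem (by exact hs)]
    congr 1
    rw [← expMeasure_Ioi hlam (sub_nonneg.2 hs), ← hl (n + 1),
      Measure.map_apply (hm (n + 1)) measurableSet_Ioi,
      ← lintegral_indicator_one ((hm (n + 1)) measurableSet_Ioi)]
    refine lintegral_congr fun ω => ?_
    simp [indicator, hs, sub_lt_iff_lt_add']
  · rw [indicator_of_notMem (by exact hs)]
    simp [indicator, hs]

lemma measure_partialSum_le_lt_of_neg (hm : ∀ n, Measurable (σ n))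
    (hl : ∀ n, P.map (σ n) = expMeasure lam) (n : ℕ) {b : ℝ} (hb : b < 0) :
    P {ω | ∑ i ∈ Finset.range n, σ i ω ≤ b ∧ b < ∑ i ∈ Finset.range n, σ i ω + σ n ω} = 0 := by
  refine measure_mono_null ?_ (ae_iff.1 (ae_nonneg_wait hm hl))
  intro ω hω h
  exact absurd (Finset.sum_nonneg fun i (_ : i ∈ Finset.range n) => h i)
    (not_le.2 (hω.1.trans_lt hb))

end Waiting

/-! ### Forward and backward times of the unit-velocity path -/

section UnitPath

variable {Ω : Type*}

/-- The event that exactly `n` changes of direction occur up to time `t`. -/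
def countEvent (τ : ℕ → Ω → ℝ) (t : ℝ) (n : ℕ) : Set Ω :=
  {ω | ∑ i ∈ Finset.range n, τ i ω ≤ t ∧ t < ∑ i ∈ Finset.range n, τ i ω + τ n ω}

/-- The position at time `t` of the path with unit velocity and positive initial direction which
has changed its direction `n` times. -/
def unitPosition (τ : ℕ → Ω → ℝ) (t : ℝ) (n : ℕ) (ω : Ω) : ℝ :=
  ∑ i ∈ Finset.range n, (-1) ^ i * τ i ω + (-1) ^ n * (t - ∑ i ∈ Finset.range n, τ i ω)

lemma sum_range_two_mul (x : ℕ → ℝ) (k : ℕ) : ∑ i ∈ Finset.range (2 * k), x i =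
    ∑ i ∈ Finset.range k, x (2 * i) + ∑ i ∈ Finset.range k, x (2 * i + 1) := by
  induction k with
  | zero => simp
  | succ k ih =>
    rw [show 2 * (k + 1) = 2 * k + 1 + 1 by ring, Finset.sum_range_succ, Finset.sum_range_succ, ih,
      Finset.sum_range_succ _ k, Finset.sum_range_succ _ k]
    ring

lemma sum_range_two_mul_alternating (x : ℕ → ℝ) (k : ℕ) :
    ∑ i ∈ Finset.range (2 * k), (-1) ^ i * x i =
    ∑ i ∈ Finset.range k, x (2 * i) - ∑ i ∈ Finset.range k, x (2 * i + 1) := by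
  rw [sum_range_two_mul, sub_eq_add_neg, ← Finset.sum_neg_distrib]
  simp [pow_succ, pow_mul]

/-- Even-indexed waits are spent moving forwards, odd-indexed ones backwards. At time `t` the path
moves backwards, so its forward legs are complete and the unfinished wait is an odd-indexed one. -/
lemma countEvent_odd (τ : ℕ → Ω → ℝ) (t : ℝ) (k : ℕ) : countEvent τ t (2 * k + 1) =
    {ω | ∑ i ∈ Finset.range (k + 1), τ (2 * i) ω + ∑ i ∈ Finset.range k, τ (2 * i + 1) ω ≤ t ∧
      t < ∑ i ∈ Finset.range (k + 1), τ (2 * i) ω + (∑ i ∈ Finset.range k, τ (2 * i + 1) ω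
        + τ (2 * k + 1) ω)} := by
  ext ω
  have : ∑ i ∈ Finset.range (2 * k + 1), τ i ω =
      ∑ i ∈ Finset.range (k + 1), τ (2 * i) ω + ∑ i ∈ Finset.range k, τ (2 * i + 1) ω := by
    rw [Finset.sum_range_succ, sum_range_two_mul (fun i => τ i ω), Finset.sum_range_succ _ k]
    ring
  simp only [countEvent, mem_ofPred_eq, this, add_assoc]

lemma countEvent_even (τ : ℕ → Ω → ℝ) (t : ℝ) (k : ℕ) : countEvent τ t (2 * k + 2) =
    {ω | ∑ i ∈ Finset.range (k + 1), τ (2 * i + 1) ω + ∑ i ∈ Finset.range (k + 1), τ (2 * i) ω ≤ t ∧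
      t < ∑ i ∈ Finset.range (k + 1), τ (2 * i + 1) ω + (∑ i ∈ Finset.range (k + 1), τ (2 * i) ω
        + τ (2 * (k + 1)) ω)} := by
  ext ω
  simp only [countEvent, mem_ofPred_eq, show 2 * k + 2 = 2 * (k + 1) by ring,
    sum_range_two_mul (fun i => τ i ω), ← add_assoc, add_comm (∑ i ∈ Finset.range (k + 1), τ (2 * i) ω)
      (∑ i ∈ Finset.range (k + 1), τ (2 * i + 1) ω)]

/-- The position is forward minus backward time, and the two add up to `t`. -/
lemma unitPosition_odd (τ : ℕ → Ω → ℝ) (t : ℝ) (k : ℕ) (ω : Ω) :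
    unitPosition τ t (2 * k + 1) ω = 2 * ∑ i ∈ Finset.range (k + 1), τ (2 * i) ω - t := by
  rw [unitPosition, Finset.sum_range_succ, Finset.sum_range_succ _ (2 * k),
    sum_range_two_mul_alternating (fun i => τ i ω), sum_range_two_mul (fun i => τ i ω),
    Finset.sum_range_succ _ k]
  rw [pow_succ, pow_mul, neg_one_sq, one_pow]
  ring

lemma unitPosition_even (τ : ℕ → Ω → ℝ) (t : ℝ) (k : ℕ) (ω : Ω) :
    unitPosition τ t (2 * k + 2) ω = t - 2 * ∑ i ∈ Finset.range (k + 1), τ (2 * i + 1) ω := by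
  rw [unitPosition, show 2 * k + 2 = 2 * (k + 1) by ring,
    sum_range_two_mul_alternating (fun i => τ i ω), sum_range_two_mul (fun i => τ i ω)]
  simp only [pow_mul, neg_one_sq, one_pow]
  ring

lemma measurableSet_countEvent [MeasurableSpace Ω] {τ : ℕ → Ω → ℝ} (hm : ∀ n, Measurable (τ n))
    (t : ℝ) (n : ℕ) : MeasurableSet (countEvent τ t n) := by
  have hS : Measurable fun ω => ∑ i ∈ Finset.range n, τ i ω :=
    Finset.measurable_fun_sum _ fun i _ => hm i
  exact (measurableSet_le hS measurable_const).inter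
    (measurableSet_lt measurable_const (hS.add (hm n)))

lemma measurable_unitPosition [MeasurableSpace Ω] {τ : ℕ → Ω → ℝ} (hm : ∀ n, Measurable (τ n))
    (t : ℝ) (n : ℕ) : Measurable (unitPosition τ t n) := by
  unfold unitPosition
  fun_prop

end UnitPath

/-! ### The law for unit velocity -/

section UnitLaw

variable {Ω : Type*} [MeasurableSpace Ω] {P : Measure Ω} {lam : ℝ} {τ : ℕ → Ω → ℝ}

lemma indepFun_partialSum_disjoint (hm : ∀ n, Measurable (τ n)) (hi : iIndepFun τ P) {f f' : ℕ → ℕ}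
    (hff : ∀ i j, f i ≠ f' j) (n m : ℕ) :
    IndepFun (fun ω => ∑ i ∈ Finset.range n, τ (f i) ω)
      (fun ω => (∑ i ∈ Finset.range m, τ (f' i) ω, τ (f' m) ω)) P := by
  classical
  set S := (Finset.range n).image f
  set S' := (Finset.range (m + 1)).image f'
  have hdis : Disjoint S S' := by
    rw [Finset.disjoint_left]
    intro x hx hx'
    obtain ⟨i, _, rfl⟩ := Finset.mem_image.1 hx
    obtain ⟨j, _, hj⟩ := Finset.mem_image.1 hx'
    exact hff i j hj.symm
  have hS : ∀ i ∈ Finset.range n, f i ∈ S := fun i hi => Finset.mem_image_of_mem f hi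
  have hS' : ∀ i ∈ Finset.range (m + 1), f' i ∈ S' := fun i hi => Finset.mem_image_of_mem f' hi
  -- The value `0` off `R` only makes the coordinate total; every index used below lies in its set.
  have hmeas : ∀ (R : Finset ℕ) (j : ℕ),
      Measurable fun x : R → ℝ => if h : j ∈ R then x ⟨j, h⟩ else 0 := by
    intro R j
    by_cases h : j ∈ R
    · simpa only [h, dite_true] using measurable_pi_apply _
    · simpa only [h, dite_false] using measurable_const
  have := (hi.indepFun_finset S S' hdis hm).comp
    (φ := fun x => ∑ i ∈ Finset.range n, if h : f i ∈ S then x ⟨f i, h⟩ else 0)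
    (ψ := fun x => (∑ i ∈ Finset.range m, if h : f' i ∈ S' then x ⟨f' i, h⟩ else 0,
      if h : f' m ∈ S' then x ⟨f' m, h⟩ else 0))
    (Finset.measurable_fun_sum _ fun i _ => hmeas S (f i))
    ((Finset.measurable_fun_sum _ fun i _ => hmeas S' (f' i)).prodMk (hmeas S' (f' m)))
  convert this using 1
  · ext ω
    exact Finset.sum_congr rfl fun i hi => by rw [dif_pos (hS i hi)]
  · ext ω
    · simp only [Function.comp_apply]
      refine Finset.sum_congr rfl fun i hi => ?_
      rw [dif_pos (hS' i (Finset.range_mono m.le_succ hi))]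
    · simp [hS' m (Finset.self_mem_range_succ m)]

/-- The joint law of a sum of `n + 1` waiting times and of the event that exactly `m` further
waiting times, from a disjoint subsequence, fit into the remaining time. -/
lemma lintegral_partialSum_disjoint [IsProbabilityMeasure P] (hlam : 0 < lam)
    (hm : ∀ n, Measurable (τ n)) (hl : ∀ n, P.map (τ n) = expMeasure lam) (hi : iIndepFun τ P)
    {f f' : ℕ → ℕ} (hf : f.Injective) (hf' : f'.Injective) (hff : ∀ i j, f i ≠ f' j) (n m : ℕ)
    {t : ℝ} {g : ℝ → ENNReal} (hg : Measurable g) :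
    ∫⁻ ω in {ω | ∑ i ∈ Finset.range (n + 1), τ (f i) ω + ∑ i ∈ Finset.range m, τ (f' i) ω ≤ t ∧
      t < ∑ i ∈ Finset.range (n + 1), τ (f i) ω + (∑ i ∈ Finset.range m, τ (f' i) ω + τ (f' m) ω)},
      g (∑ i ∈ Finset.range (n + 1), τ (f i) ω) ∂P =
    ∫⁻ u in Ioc 0 t, ENNReal.ofReal (lam * poissonWeight lam n u) *
      (ENNReal.ofReal (poissonWeight lam m (t - u)) * g u) := by
  have hU : Measurable fun ω => ∑ i ∈ Finset.range (n + 1), τ (f i) ω :=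
    Finset.measurable_fun_sum _ fun i _ => hm _
  have hV : Measurable fun ω => ∑ i ∈ Finset.range m, τ (f' i) ω :=
    Finset.measurable_fun_sum _ fun i _ => hm _
  have hVW := hV.prodMk (hm (f' m))
  have hset : MeasurableSet {p : ℝ × ℝ × ℝ | p.1 + p.2.1 ≤ t ∧ t < p.1 + (p.2.1 + p.2.2)} :=
    (measurableSet_le (measurable_fst.add measurable_snd.fst) measurable_const).inter
      (measurableSet_lt measurable_const
        (measurable_fst.add (measurable_snd.fst.add measurable_snd.snd)))
  have hG : Measurable fun p : ℝ × ℝ × ℝ =>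
      {p : ℝ × ℝ × ℝ | p.1 + p.2.1 ≤ t ∧ t < p.1 + (p.2.1 + p.2.2)}.indicator
        (fun p => g p.1) p := (hg.comp measurable_fst).indicator hset
  have key := lintegral_indepFun hU hVW (indepFun_partialSum_disjoint hm hi hff (n + 1) m) hG
  refine (lintegral_indicator ((hU.prodMk hVW) hset) _).symm.trans ?_
  refine (lintegral_congr fun ω => rfl).trans (key.trans ?_)
  have hmeas : Measurable fun u => ∫⁻ ω,
      {p : ℝ × ℝ × ℝ | p.1 + p.2.1 ≤ t ∧ t < p.1 + (p.2.1 + p.2.2)}.indicator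
        (fun p => g p.1) (u, ∑ i ∈ Finset.range m, τ (f' i) ω, τ (f' m) ω) ∂P :=
    (hG.comp (measurable_fst.prodMk (hVW.comp measurable_snd))).lintegral_prod_right'
  rw [lintegral_partialSum_succ (σ := fun i => τ (f i)) hlam (fun i => hm _) (fun i => hl _)
    (hi.precomp hf) n hmeas,
    ← Ioi_inter_Iic, inter_comm, ← setLIntegral_indicator measurableSet_Iic]
  refine setLIntegral_congr_fun measurableSet_Ioi fun u _ => ?_
  have hE : MeasurableSet {ω | ∑ i ∈ Finset.range m, τ (f' i) ω ≤ t - u ∧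
      t - u < ∑ i ∈ Finset.range m, τ (f' i) ω + τ (f' m) ω} :=
    (measurableSet_le hV measurable_const).inter
      (measurableSet_lt measurable_const (hV.add (hm _)))
  -- With the first sum frozen at `u`, the event says that the other subsequence makes exactly `m`
  -- renewals by time `t - u`.
  have hinner : ∫⁻ ω, {p : ℝ × ℝ × ℝ | p.1 + p.2.1 ≤ t ∧ t < p.1 + (p.2.1 + p.2.2)}.indicator
        (fun p => g p.1) (u, ∑ i ∈ Finset.range m, τ (f' i) ω, τ (f' m) ω) ∂P =
      P {ω | ∑ i ∈ Finset.range m, τ (f' i) ω ≤ t - u ∧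
        t - u < ∑ i ∈ Finset.range m, τ (f' i) ω + τ (f' m) ω} * g u := by
    rw [mul_comm, ← lintegral_indicator_const hE]
    refine lintegral_congr fun ω => ?_
    simp only [indicator, mem_ofPred_eq, le_sub_iff_add_le', sub_lt_iff_lt_add']
  have hσm : ∀ i, Measurable ((fun i => τ (f' i)) i) := fun i => hm _
  have hσl : ∀ i, P.map ((fun i => τ (f' i)) i) = expMeasure lam := fun i => hl _
  by_cases hu : u ≤ t
  · rw [indicator_of_mem (by exact hu), hinner]
    congr 2
    exact measure_partialSum_le_lt hlam hσm hσl (hi.precomp hf') m (sub_nonneg.2 hu)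
  · rw [indicator_of_notMem (by exact hu), hinner]
    have := measure_partialSum_le_lt_of_neg hσm hσl m (sub_neg.2 (not_le.1 hu))
    rw [this, zero_mul, mul_zero]

/-- The density of the position of the unit-velocity path on the event that `k + m + 1` changes of
direction occur, in terms of the time spent in each direction. -/
def countDensity (lam t : ℝ) (k m : ℕ) (w : ℝ) : ℝ :=
  lam / 2 * poissonWeight lam k ((t + w) / 2) * poissonWeight lam m ((t - w) / 2)

@[fun_prop]
lemma continuous_countDensity (lam t : ℝ) (k m : ℕ) : Continuous (countDensity lam t k m) := by
  unfold countDensity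
  fun_prop

lemma countDensity_nonneg {t w : ℝ} (hlam : 0 < lam) (hw : w ∈ Ioo (-t) t) (k m : ℕ) :
    0 ≤ countDensity lam t k m w := by
  have h1 := poissonWeight_nonneg hlam.le (show 0 ≤ (t + w) / 2 by linarith [hw.1]) k
  have h2 := poissonWeight_nonneg hlam.le (show 0 ≤ (t - w) / 2 by linarith [hw.2]) m
  unfold countDensity
  positivity

lemma lintegral_poissonWeight_mul_eq {t : ℝ} (hlam : 0 < lam) (ht : 0 < t) (k m : ℕ)
    {G : ℝ → ENNReal} (hG : Measurable G) :
    ∫⁻ u in Ioc 0 t, ENNReal.ofReal (lam * poissonWeight lam k u) *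
      (ENNReal.ofReal (poissonWeight lam m (t - u)) * G (2 * u - t)) =
    ∫⁻ w in Ioo (-t) t, ENNReal.ofReal (countDensity lam t k m w) * G w := by
  have hmeas : Measurable fun w => ENNReal.ofReal (countDensity lam t k m w) * G w :=
    (continuous_countDensity lam t k m).measurable.ennreal_ofReal.mul hG
  -- The Jacobian `2` of `w = 2 * u - t` cancels the `1 / 2` in `countDensity`.
  have key := lintegral_comp_primitive (a := 0) (b := t) (h := fun _ => 2) (F := fun u => 2 * u - t)
    ht.le intervalIntegrable_const (fun _ => by norm_num) (fun s _ => by simp; ring) hmeas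
  simp only [mul_zero, zero_sub, show 2 * t - t = t by ring] at key
  rw [setLIntegral_congr Ioo_ae_eq_Ioc, ← key]
  refine setLIntegral_congr_fun measurableSet_Ioc fun u hu => ?_
  have h1 := poissonWeight_nonneg hlam.le hu.1.le k
  rw [← mul_assoc, ← mul_assoc, ← ENNReal.ofReal_mul (by positivity),
    ← ENNReal.ofReal_mul (by norm_num), countDensity]
  simp only [show (t + (2 * u - t)) / 2 = u by ring, show (t - (2 * u - t)) / 2 = t - u by ring]
  congr 2
  ring

lemma lintegral_unitPosition_odd [IsProbabilityMeasure P] {t : ℝ} (hlam : 0 < lam) (ht : 0 < t)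
    (hm : ∀ n, Measurable (τ n)) (hl : ∀ n, P.map (τ n) = expMeasure lam) (hi : iIndepFun τ P)
    (k : ℕ) {G : ℝ → ENNReal} (hG : Measurable G) :
    ∫⁻ ω in countEvent τ t (2 * k + 1), G (unitPosition τ t (2 * k + 1) ω) ∂P =
      ∫⁻ w in Ioo (-t) t, ENNReal.ofReal (countDensity lam t k k w) * G w := by
  simp only [countEvent_odd, unitPosition_odd]
  rw [← lintegral_poissonWeight_mul_eq hlam ht k k hG]
  exact lintegral_partialSum_disjoint (f := fun i => 2 * i) (f' := fun i => 2 * i + 1)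
    (g := fun u => G (2 * u - t)) hlam hm hl hi (fun i j h => by simpa using h)
    (fun i j h => by simpa using h) (fun i j => by omega) k k (hG.comp (by fun_prop))

/-- The position is now `t - 2U` with `U` the backward time. For even `G` it may be replaced by `2U
- t`, which reduces to the same integral as the odd case; the random initial direction makes this
enough. -/
lemma lintegral_unitPosition_even [IsProbabilityMeasure P] {t : ℝ} (hlam : 0 < lam) (ht : 0 < t)
    (hm : ∀ n, Measurable (τ n)) (hl : ∀ n, P.map (τ n) = expMeasure lam) (hi : iIndepFun τ P)
    (k : ℕ) {G : ℝ → ENNReal} (hG : Measurable G) (hGs : ∀ w, G (-w) = G w) :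
    ∫⁻ ω in countEvent τ t (2 * k + 2), G (unitPosition τ t (2 * k + 2) ω) ∂P =
      ∫⁻ w in Ioo (-t) t, ENNReal.ofReal (countDensity lam t k (k + 1) w) * G w := by
  simp only [countEvent_even, unitPosition_even]
  rw [← lintegral_poissonWeight_mul_eq hlam ht k (k + 1) hG]
  simp only [← hGs (t - _), neg_sub]
  exact lintegral_partialSum_disjoint (f := fun i => 2 * i + 1) (f' := fun i => 2 * i)
    (g := fun u => G (2 * u - t)) hlam hm hl hi (fun i j h => by simpa using h)
    (fun i j h => by simpa using h) (fun i j => by omega) k (k + 1) (hG.comp (by fun_prop))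

/-- With `a = lam * (t + w) / 2` and `b = lam * (t - w) / 2`, the equal-count terms contain `(a * b)
^ k`. Averaging the unequal ones over `±w` yields `(a * b) ^ k * (a + b) / 2`, and `a + b = lam * t`
is the factor before `besselSeries 1`. -/
lemma hasSum_countDensity (lam t w : ℝ) :
    HasSum (fun k => (countDensity lam t k k w + countDensity lam t k k (-w)) / 2 +
      (countDensity lam t k (k + 1) w + countDensity lam t k (k + 1) (-w)) / 2)
      (unitDensity lam w t) := by
  have h0 := (summable_besselSeries 0 (lam ^ 2 * (t ^ 2 - w ^ 2) / 4)).hasSum.mul_left lam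
  have h1 := (summable_besselSeries 1 (lam ^ 2 * (t ^ 2 - w ^ 2) / 4)).hasSum.mul_left
    (lam ^ 2 / 2 * t)
  convert! (h0.add h1).mul_left (Real.exp (-lam * t) / 2) using 1
  ext k
  have he : Real.exp (-lam * t) =
      Real.exp (-(lam * ((t + w) / 2))) * Real.exp (-(lam * ((t - w) / 2))) := by
    rw [← Real.exp_add]; ring_nf
  have h2 : (k.factorial : ℝ) ≠ 0 := by exact_mod_cast Nat.factorial_ne_zero k
  have h3 : (k : ℝ) + 1 ≠ 0 := by positivity
  have hv : (lam ^ 2 * (t ^ 2 - w ^ 2) / 4) ^ k =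
      (lam * ((t + w) / 2)) ^ k * (lam * ((t - w) / 2)) ^ k := by
    rw [← mul_pow]; ring_nf
  rw [hv]
  simp only [countDensity, poissonWeight, he, ← sub_eq_add_neg, sub_neg_eq_add,
    Nat.factorial_succ, Nat.add_zero, pow_succ]
  push_cast
  field_simp
  ring

lemma setLIntegral_Ioo_neg (t : ℝ) (F : ℝ → ENNReal) :
    ∫⁻ w in Ioo (-t) t, F (-w) = ∫⁻ w in Ioo (-t) t, F w := by
  rw [← lintegral_indicator measurableSet_Ioo, ← lintegral_indicator measurableSet_Ioo,
    ← lintegral_neg_eq_self (μ := volume) ((Ioo (-t) t).indicator F)]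
  refine lintegral_congr fun w => ?_
  have : w ∈ Ioo (-t) t ↔ -w ∈ Ioo (-t) t := by
    simp only [mem_Ioo, neg_lt_neg_iff, neg_lt (a := w), and_comm]
  by_cases hw : w ∈ Ioo (-t) t
  · rw [indicator_of_mem hw, indicator_of_mem (this.1 hw)]
  · rw [indicator_of_notMem hw, indicator_of_notMem (mt this.2 hw)]

lemma setLIntegral_symmetrize {t : ℝ} {q : ℝ → ℝ} (hq : Measurable q)
    (hq0 : ∀ w ∈ Ioo (-t) t, 0 ≤ q w) {g : ℝ → ENNReal} (hg : Measurable g) :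
    2⁻¹ * ∫⁻ w in Ioo (-t) t, ENNReal.ofReal (q w) * (g w + g (-w)) =
      ∫⁻ w in Ioo (-t) t, ENNReal.ofReal ((q w + q (-w)) / 2) * g w := by
  have h1 : ∫⁻ w in Ioo (-t) t, ENNReal.ofReal (q w) * g (-w) =
      ∫⁻ w in Ioo (-t) t, ENNReal.ofReal (q (-w)) * g w := by
    rw [← setLIntegral_Ioo_neg t fun w => ENNReal.ofReal (q (-w)) * g w]
    simp only [neg_neg]
  simp only [mul_add]
  have h0 : Measurable fun w => ENNReal.ofReal (q w) * g w := by fun_prop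
  rw [lintegral_add_left h0, h1, ← lintegral_add_left h0,
    ← lintegral_const_mul _ (by fun_prop)]
  refine setLIntegral_congr_fun measurableSet_Ioo fun w hw => ?_
  have hw' : -w ∈ Ioo (-t) t := ⟨by linarith [hw.2], by linarith [hw.1]⟩
  have h2 : (2⁻¹ : ENNReal) = ENNReal.ofReal 2⁻¹ := by
    rw [ENNReal.ofReal_inv_of_pos (by norm_num), ENNReal.ofReal_ofNat]
  rw [← add_mul, ← ENNReal.ofReal_add (hq0 w hw) (hq0 _ hw'), ← mul_assoc, h2,
    ← ENNReal.ofReal_mul (by norm_num)]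
  congr 2
  ring

/-- The law of the telegraph process with unit velocity, as a sum over the number of changes of
direction. -/
lemma tsum_lintegral_unitPosition [IsProbabilityMeasure P] {t : ℝ} (hlam : 0 < lam) (ht : 0 < t)
    (hm : ∀ n, Measurable (τ n)) (hl : ∀ n, P.map (τ n) = expMeasure lam) (hi : iIndepFun τ P)
    {g : ℝ → ENNReal} (hg : Measurable g) :
    ∑' n, 2⁻¹ * ∫⁻ ω in countEvent τ t n, g (unitPosition τ t n ω) + g (-unitPosition τ t n ω) ∂P =
      ENNReal.ofReal (Real.exp (-lam * t) / 2) * (g (-t) + g t) +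
        ∫⁻ w in Ioo (-t) t, ENNReal.ofReal (unitDensity lam w t) * g w := by
  have hG : Measurable fun w => g w + g (-w) := hg.add (hg.comp measurable_neg)
  have hGs : ∀ w, g (-w) + g (- -w) = g w + g (-w) := fun w => by rw [neg_neg, add_comm]
  have hterm : ∀ k m, Measurable fun w => ENNReal.ofReal
      ((countDensity lam t k m w + countDensity lam t k m (-w)) / 2) * g w := by
    intro k m
    have : Continuous fun w => (countDensity lam t k m w + countDensity lam t k m (-w)) / 2 := by
      fun_prop
    exact this.measurable.ennreal_ofReal.mul hg
  rw [tsum_eq_zero_add' ENNReal.summable]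
  congr 1
  · have h0 : ∀ ω, unitPosition τ t 0 ω = t := fun ω => by simp [unitPosition]
    have h1 : P (countEvent τ t 0) = _ := measure_partialSum_le_lt hlam hm hl hi 0 ht.le
    simp only [h0, lintegral_const, Measure.restrict_apply_univ]
    rw [h1, add_comm (g t), mul_comm _ (ENNReal.ofReal _),
      ← mul_assoc]
    congr 1
    rw [div_eq_inv_mul, ENNReal.ofReal_mul (by norm_num), ENNReal.ofReal_inv_of_pos (by norm_num),
      ENNReal.ofReal_ofNat]
    simp [poissonWeight]
  -- The counts `2k + 1` and `2k + 2` together form the `k`-th term of the Bessel series.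
  · rw [← tsum_even_add_odd ENNReal.summable ENNReal.summable, ← ENNReal.tsum_add]
    have hk : ∀ k, 2⁻¹ * ∫⁻ ω in countEvent τ t (2 * k + 1), g (unitPosition τ t (2 * k + 1) ω) +
          g (-unitPosition τ t (2 * k + 1) ω) ∂P +
        2⁻¹ * ∫⁻ ω in countEvent τ t (2 * k + 1 + 1), g (unitPosition τ t (2 * k + 1 + 1) ω) +
          g (-unitPosition τ t (2 * k + 1 + 1) ω) ∂P =
        ∫⁻ w in Ioo (-t) t, ENNReal.ofReal
          ((countDensity lam t k k w + countDensity lam t k k (-w)) / 2 +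
            (countDensity lam t k (k + 1) w + countDensity lam t k (k + 1) (-w)) / 2) * g w := by
      intro k
      rw [lintegral_unitPosition_odd hlam ht hm hl hi k hG,
        lintegral_unitPosition_even hlam ht hm hl hi k hG hGs,
        setLIntegral_symmetrize (continuous_countDensity lam t k k).measurable
          (fun w hw => countDensity_nonneg hlam hw k k) hg,
        setLIntegral_symmetrize (continuous_countDensity lam t k (k + 1)).measurable
          (fun w hw => countDensity_nonneg hlam hw k (k + 1)) hg,
        ← lintegral_add_left (hterm k k)]
      refine setLIntegral_congr_fun measurableSet_Ioo fun w hw => ?_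
      have hw' : -w ∈ Ioo (-t) t := ⟨by linarith [hw.2], by linarith [hw.1]⟩
      have h1 := countDensity_nonneg hlam hw k k
      have h2 := countDensity_nonneg hlam hw' k k
      have h3 := countDensity_nonneg hlam hw k (k + 1)
      have h4 := countDensity_nonneg hlam hw' k (k + 1)
      rw [← add_mul, ENNReal.ofReal_add (by positivity) (by positivity)]
    rw [tsum_congr hk, ← lintegral_tsum]
    · refine setLIntegral_congr_fun measurableSet_Ioo fun w hw => ?_
      have hw' : -w ∈ Ioo (-t) t := ⟨by linarith [hw.2], by linarith [hw.1]⟩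
      have hs := hasSum_countDensity lam t w
      rw [ENNReal.tsum_mul_right, ← ENNReal.ofReal_tsum_of_nonneg _ hs.summable, hs.tsum_eq]
      intro k
      have h1 := countDensity_nonneg hlam hw k k
      have h2 := countDensity_nonneg hlam hw' k k
      have h3 := countDensity_nonneg hlam hw k (k + 1)
      have h4 := countDensity_nonneg hlam hw' k (k + 1)
      positivity
    · intro k
      have : Continuous fun w => (countDensity lam t k k w + countDensity lam t k k (-w)) / 2 +
            (countDensity lam t k (k + 1) w + countDensity lam t k (k + 1) (-w)) / 2 := by
        fun_prop
      exact (this.measurable.ennreal_ofReal.mul hg).aemeasurable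

end UnitLaw

/-! ### The law of the travel time of the process -/

section Law

variable {Ω : Type*} [MeasurableSpace Ω] {P : Measure Ω} {c : ℝ → ℝ}
  {lam T t : ℝ} {τ : ℕ → Ω → ℝ} {ε : Ω → ℝ} {X : ℝ → Ω → ℝ}

lemma IsTelegraphProcess.ae_dir [IsProbabilityMeasure P]
    (hX : IsTelegraphProcess P c lam T τ ε X) :
    ∀ᵐ ω ∂P, ε ω = 1 ∨ ε ω = -1 := by
  have hm1 : MeasurableSet {ω | ε ω = 1} := hX.measurable_dir (measurableSet_singleton 1)
  have hm2 : MeasurableSet {ω | ε ω = -1} := hX.measurable_dir (measurableSet_singleton (-1))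
  have hd : Disjoint {ω | ε ω = 1} {ω | ε ω = -1} := by
    rw [Set.disjoint_left]
    intro ω (h1 : ε ω = 1) (h2 : ε ω = -1)
    linarith
  refine (mem_ae_iff_prob_eq_one (hm1.union hm2)).2 ?_
  rw [measure_union hd hm2, hX.dir_pos, hX.dir_neg, ENNReal.add_halves]

lemma IsTelegraphProcess.ae_nonneg_wait (hX : IsTelegraphProcess P c lam T τ ε X) :
    ∀ᵐ ω ∂P, ∀ n, 0 ≤ τ n ω :=
  VarTelegraph.ae_nonneg_wait hX.measurable_wait hX.law_wait

lemma IsTelegraphProcess.lintegral_mul_dir (hX : IsTelegraphProcess P c lam T τ ε X)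
    {Φ : (ℕ → ℝ) → ENNReal} (hΦ : Measurable Φ) {d : ℝ} (hd : P {ω | ε ω = d} = 1 / 2) :
    ∫⁻ ω, Φ (fun n => τ n ω) * ({d} : Set ℝ).indicator 1 (ε ω) ∂P =
      2⁻¹ * ∫⁻ ω, Φ (fun n => τ n ω) ∂P := by
  have hind : Measurable (({d} : Set ℝ).indicator (1 : ℝ → ENNReal)) :=
    measurable_one.indicator (measurableSet_singleton d)
  have hτ : Measurable fun ω n => τ n ω := measurable_pi_lambda _ hX.measurable_wait
  have hmul := lintegral_mul_eq_lintegral_mul_lintegral_of_indepFun'' (hΦ.comp hτ).aemeasurable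
    (hind.comp hX.measurable_dir).aemeasurable (hX.indep_dir.comp hΦ hind)
  simp only [Function.comp_apply] at hmul
  rw [hmul, mul_comm]
  congr 1
  rw [← lintegral_map hind hX.measurable_dir, lintegral_indicator_one (measurableSet_singleton d),
    Measure.map_apply hX.measurable_dir (measurableSet_singleton d), ← one_div, ← hd]
  rfl

lemma IsTelegraphProcess.lintegral_countEvent [IsProbabilityMeasure P]
    (hX : IsTelegraphProcess P c lam T τ ε X) (n : ℕ)
    {g : ℝ → ENNReal} (hg : Measurable g) :
    ∫⁻ ω in countEvent τ t n, g (ε ω * unitPosition τ t n ω) ∂P =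
      2⁻¹ * ∫⁻ ω in countEvent τ t n, g (unitPosition τ t n ω) + g (-unitPosition τ t n ω) ∂P := by
  have hD := measurableSet_countEvent hX.measurable_wait t n
  -- Independence of `ε` concerns the whole sequence of waits, so event and position are written as
  -- functions on sequence space.
  set Φ : (ℝ → ENNReal) → (ℕ → ℝ) → ENNReal := fun f =>
    (countEvent (fun i (x : ℕ → ℝ) => x i) t n).indicator
      fun x => f (unitPosition (fun i (x : ℕ → ℝ) => x i) t n x)
  have hΦ : ∀ {f}, Measurable f → Measurable (Φ f) := fun {f} hf =>
    (hf.comp (measurable_unitPosition (fun i => measurable_pi_apply i) t n)).indicator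
      (measurableSet_countEvent (fun i => measurable_pi_apply i) t n)
  have hΦτ : ∀ f ω, Φ f (fun i => τ i ω) =
      (countEvent τ t n).indicator (fun ω => f (unitPosition τ t n ω)) ω := fun f ω => rfl
  have hgn : Measurable fun w => g (-w) := hg.comp measurable_neg
  have hτ : Measurable fun ω n => τ n ω := measurable_pi_lambda _ hX.measurable_wait
  have hm1 : Measurable fun ω => Φ g (fun n => τ n ω) * ({1} : Set ℝ).indicator 1 (ε ω) :=
    ((hΦ hg).comp hτ).mul
      ((measurable_one.indicator (measurableSet_singleton 1)).comp hX.measurable_dir)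
  have hm2 : Measurable fun ω => Φ g (fun n => τ n ω) := (hΦ hg).comp hτ
  calc ∫⁻ ω in countEvent τ t n, g (ε ω * unitPosition τ t n ω) ∂P
      = ∫⁻ ω, Φ g (fun n => τ n ω) * ({1} : Set ℝ).indicator 1 (ε ω) +
          Φ (fun w => g (-w)) (fun n => τ n ω) * ({-1} : Set ℝ).indicator 1 (ε ω) ∂P := by
        rw [← lintegral_indicator hD]
        refine lintegral_congr_ae ?_
        filter_upwards [hX.ae_dir] with ω hω
        rw [hΦτ g, hΦτ fun w => g (-w)]
        by_cases h : ω ∈ countEvent τ t n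
        · rcases hω with h' | h' <;> norm_num [h, h', indicator]
        · simp [h]
    _ = 2⁻¹ * ∫⁻ ω, Φ g (fun n => τ n ω) + Φ (fun w => g (-w)) (fun n => τ n ω) ∂P := by
        rw [lintegral_add_left hm1, hX.lintegral_mul_dir (hΦ hg) hX.dir_pos,
          hX.lintegral_mul_dir (hΦ hgn) hX.dir_neg, lintegral_add_left hm2, mul_add]
    _ = _ := by
        rw [← lintegral_indicator hD]
        congr 1
        refine lintegral_congr fun ω => ?_
        rw [hΦτ g, hΦτ fun w => g (-w), indicator_add]

/-- The travel time of a telegraph process is a telegraph process with unit velocity. -/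
lemma IsTelegraphProcess.lintegral_travelTime [IsProbabilityMeasure P]
    (hX : IsTelegraphProcess P c lam T τ ε X)
    (hc_meas : Measurable c) (hc_pos : ∀ x, 0 < c x)
    (hc_int : ∀ x, IntervalIntegrable (fun w => (c w)⁻¹) volume 0 x) (hlam : 0 < lam)
    (ht : 0 < t) (htT : t ≤ T) {g : ℝ → ENNReal} (hg : Measurable g) :
    ∫⁻ ω, g (travelTime c (X t ω)) ∂P =
      ENNReal.ofReal (Real.exp (-lam * t) / 2) * (g (-t) + g t) +
        ∫⁻ w in Ioo (-t) t, ENNReal.ofReal (unitDensity lam w t) * g w := by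
  have hD := measurableSet_countEvent hX.measurable_wait t
  have hdisj : Pairwise (Function.onFun (AEDisjoint P) (countEvent τ t)) := by
    intro n m hnm
    refine measure_mono_null ?_ (ae_iff.1 hX.ae_nonneg_wait)
    rintro ω ⟨h1, h2⟩ hω
    refine hnm ((switchCount_eq hω h1.1 ?_).symm.trans (switchCount_eq hω h2.1 ?_))
    · rw [Finset.sum_range_succ]; exact h1.2
    · rw [Finset.sum_range_succ]; exact h2.2
  have hprob : ∀ n, P (countEvent τ t n) = ENNReal.ofReal (poissonWeight lam n t) := fun n =>
    measure_partialSum_le_lt hlam hX.measurable_wait hX.law_wait hX.indep_wait n ht.le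
  -- Almost surely only finitely many switches occur by time `t`, since the Poisson weights sum to
  -- one.
  have hcover : ∀ᵐ ω ∂P, ω ∈ ⋃ n, countEvent τ t n := by
    refine (mem_ae_iff_prob_eq_one (MeasurableSet.iUnion hD)).2 ?_
    rw [measure_iUnion₀ hdisj fun n => (hD n).nullMeasurableSet, tsum_congr hprob,
      ← ENNReal.ofReal_tsum_of_nonneg (fun n => poissonWeight_nonneg hlam.le ht.le n)
        (hasSum_poissonWeight lam t).summable, (hasSum_poissonWeight lam t).tsum_eq,
      ENNReal.ofReal_one]
  rw [← tsum_lintegral_unitPosition hlam ht hX.measurable_wait hX.law_wait hX.indep_wait hg,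
    ← Measure.restrict_eq_self_of_ae_mem hcover,
    lintegral_iUnion₀ (fun n => (hD n).nullMeasurableSet) hdisj,
    Measure.restrict_eq_self_of_ae_mem hcover]
  refine tsum_congr fun n => ?_
  rw [← hX.lintegral_countEvent n hg]
  refine setLIntegral_congr_fun_ae (hD n) ?_
  filter_upwards [hX.ae_dir, hX.ae_nonneg_wait, hX.motion] with ω hε hτ hmot hω
  rw [travelTime_path hc_meas hc_pos hc_int hτ hε hmot.1 hmot.2 n t htT hω.1
    (by rw [Finset.sum_range_succ]; exact hω.2.le)]
  rfl

/-- The law of `travelTime c (X t)` has an atom of mass at least `exp (-lam * t) / 2` at `y`,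
impossible for a value never taken. Existence of the motion up to `T` thus replaces any assumption
on the travel time to infinity. -/
lemma IsTelegraphProcess.exists_travelTime_eq [IsProbabilityMeasure P]
    (hX : IsTelegraphProcess P c lam T τ ε X)
    (hc_meas : Measurable c) (hc_pos : ∀ x, 0 < c x)
    (hc_int : ∀ x, IntervalIntegrable (fun w => (c w)⁻¹) volume 0 x) (hlam : 0 < lam)
    (ht : 0 < t) (htT : t ≤ T) {y : ℝ} (hy : y = -t ∨ y = t) : ∃ x, travelTime c x = y := by
  by_contra! h
  have key := hX.lintegral_travelTime hc_meas hc_pos hc_int hlam ht htT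
    (measurable_one.indicator (measurableSet_singleton y) : Measurable (({y} : Set ℝ).indicator 1))
  have h0 : ∀ x, ({y} : Set ℝ).indicator (1 : ℝ → ENNReal) (travelTime c x) = 0 := fun x =>
    indicator_of_notMem (mt mem_singleton_iff.1 (h x)) _
  simp only [h0, lintegral_zero] at key
  have h1 := (add_eq_zero.1 key.symm).1
  rw [mul_eq_zero, ENNReal.ofReal_eq_zero, not_le.2 (by positivity) |> (iff_false_intro ·), false_or,
    add_eq_zero] at h1
  rcases hy with rfl | rfl
  · simpa using h1.1
  · simpa using h1.2

end Law

/-! ### Return to the original space variable -/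

lemma lintegral_acDensity {c : ℝ → ℝ} (hc_pos : ∀ x, 0 < c x)
    (hc_int : ∀ x, IntervalIntegrable (fun w => (c w)⁻¹) volume 0 x) (lam : ℝ) {t xm xp : ℝ}
    (ht : 0 < t) (hxm : travelTime c xm = -t) (hxp : travelTime c xp = t)
    {g : ℝ → ENNReal} (hg : Measurable g) :
    ∫⁻ x, ENNReal.ofReal (acDensity c lam x t) * g (travelTime c x) =
      ∫⁻ w in Ioo (-t) t, ENNReal.ofReal (unitDensity lam w t) * g w := by
  have hmono := strictMono_travelTime hc_pos hc_int
  have hle : xm ≤ xp := hmono.le_iff_le.1 (by rw [hxm, hxp]; linarith)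
  have hcont : Continuous fun w => unitDensity lam w t :=
    continuous_iff_continuousAt.2 fun w => (hasDerivAt_unitDensity_space lam w t).continuousAt
  have key := lintegral_comp_primitive (F := travelTime c) (h := fun w => (c w)⁻¹) hle
    ((hc_int xm).symm.trans (hc_int xp)) (fun w => inv_pos.2 (hc_pos w))
    (fun s _ => by rw [← travelTime_sub hc_int]; ring)
    (g := fun w => ENNReal.ofReal (unitDensity lam w t) * g w)
    (hcont.measurable.ennreal_ofReal.mul hg)
  rw [hxm, hxp] at key
  rw [setLIntegral_congr Ioo_ae_eq_Ioc, ← key, ← setLIntegral_congr Ioo_ae_eq_Ioc,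
    ← lintegral_indicator measurableSet_Ioo]
  refine lintegral_congr fun x => ?_
  have hiff : x ∈ Ioo xm xp ↔ |travelTime c x| < t := by
    rw [abs_lt, ← hxm, ← hxp, hmono.lt_iff_lt, hmono.lt_iff_lt, mem_Ioo]
  by_cases hx : x ∈ Ioo xm xp
  · rw [indicator_of_mem hx, ← mul_assoc, ← ENNReal.ofReal_mul (inv_pos.2 (hc_pos x)).le,
      ← mul_acDensity_eq_unitDensity hc_pos lam x t (hiff.1 hx), inv_mul_cancel_left₀ (hc_pos x).ne']
  · rw [indicator_of_notMem hx, acDensity,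
      indicator_of_notMem (s := {x' | |travelTime c x'| < t}) (mt hiff.2 hx), ENNReal.ofReal_zero,
      zero_mul]

end VarTelegraph

end

theorem mainTheorem7 {Ω : Type*} [MeasurableSpace Ω] (P : Measure Ω) [IsProbabilityMeasure P]
    (c : ℝ → ℝ) (hc_meas : Measurable c) (hc_pos : ∀ x, 0 < c x)
    (hc_int : ∀ x, IntervalIntegrable (fun w => (c w)⁻¹) volume 0 x)
    (lam : ℝ) (hlam : 0 < lam) (T : ℝ)
    (τ : ℕ → Ω → ℝ) (ε : Ω → ℝ) (X : ℝ → Ω → ℝ)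
    (hX : VarTelegraph.IsTelegraphProcess P c lam T τ ε X)
    (t : ℝ) (ht : 0 < t) (htT : t ≤ T) :
    (∃ xm xp : ℝ, VarTelegraph.travelTime c xm = -t ∧ VarTelegraph.travelTime c xp = t ∧
      {x : ℝ | |VarTelegraph.travelTime c x| = t} = {xm, xp} ∧
      P.map (X t) =
        ENNReal.ofReal (Real.exp (-lam * t) / 2) • (Measure.dirac xm + Measure.dirac xp) +
        volume.withDensity (fun x => ENNReal.ofReal (VarTelegraph.acDensity c lam x t))) ∧
    (Continuous c → ∀ x : ℝ, |VarTelegraph.travelTime c x| < t →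
      VarTelegraph.SolvesTelegraphEqAt c lam
        (fun x' s => c x' * VarTelegraph.acDensity c lam x' s) x t) := by
  refine ⟨?_, fun hc x hx => VarTelegraph.solvesTelegraphEqAt_acDensity hc hc_pos lam x t hx⟩
  obtain ⟨xm, hxm⟩ := hX.exists_travelTime_eq hc_meas hc_pos hc_int hlam ht htT (Or.inl rfl)
  obtain ⟨xp, hxp⟩ := hX.exists_travelTime_eq hc_meas hc_pos hc_int hlam ht htT (Or.inr rfl)
  have hmono := VarTelegraph.strictMono_travelTime hc_pos hc_int
  refine ⟨xm, xp, hxm, hxp, ?_, ?_⟩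
  · ext x
    change |VarTelegraph.travelTime c x| = t ↔ x = xm ∨ x = xp
    rw [abs_eq ht.le, ← hxm, or_comm, hmono.injective.eq_iff]
    nth_rewrite 1 [← hxp]
    rw [hmono.injective.eq_iff]
  -- Every Borel indicator is therefore `g ∘ travelTime c` with `g` measurable on the whole line, so
  -- the law of the travel time suffices.
  · have hemb : MeasurableEmbedding (VarTelegraph.travelTime c) :=
      (VarTelegraph.continuous_travelTime hc_int).measurableEmbedding hmono.injective
    ext B hB
    obtain ⟨g, hg, hgy⟩ := hemb.exists_measurable_extend
      (measurable_one.indicator hB : Measurable (B.indicator (1 : ℝ → ENNReal)))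
      fun _ => ⟨0⟩
    have hgy' : ∀ x, g (VarTelegraph.travelTime c x) = B.indicator 1 x := congrFun hgy
    have hgm : g (-t) = B.indicator 1 xm := hxm ▸ hgy' xm
    have hgp : g t = B.indicator 1 xp := (congrArg g hxp).symm.trans (hgy' xp)
    have hlaw := hX.lintegral_travelTime hc_meas hc_pos hc_int hlam ht htT hg
    rw [← VarTelegraph.lintegral_acDensity hc_pos hc_int lam ht hxm hxp hg, hgm, hgp] at hlaw
    simp only [hgy'] at hlaw
    rw [← lintegral_indicator_one hB, lintegral_map' (measurable_one.indicator hB).aemeasurable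
      (hX.aemeasurable_pos t ⟨ht.le, htT⟩), hlaw, Measure.add_apply, Measure.smul_apply,
      Measure.add_apply, Measure.dirac_apply' _ hB, Measure.dirac_apply' _ hB, smul_eq_mul,
      withDensity_apply _ hB, ← lintegral_indicator hB]
    congr 1
    refine lintegral_congr fun x => ?_
    by_cases hx : x ∈ B <;> simp [hx]
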